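/- **Setting.** Let $\Omega\subset\mathbb R^3$ be a bounded open set (e.g. a bounded polyhedral Lipschitz domain), $T>0$, $\alpha>0$, $C_{\rm exch}>0$, $1/2<\theta\le 1$, and let $m^0\in H^1(\Omega;\mathbb R^3)$ with $|m^0|=1$ a.e. Write $\langle\cdot,\cdot\rangle$ for the scalar product of $L^2(\Omega)$ (vector and matrix fields included) and $\Omega_t=(0,t)\times\Omega$. Consider mesh-sizes $h\to0$ and time steps $k=T/N\to0$ (an arbitrary sequence of pairs $(h,k)\to(0,0)$). Let $\mathcal T_h$ be conforming triangulations of $\Omega$ into tetrahedra (with $\Omega$ the interior of the union of the tetrahedra) which are uniformly shape regular and quasi-uniform with diameters comparable to $h$, and which satisfy the angle condition $\langle\nabla\eta_z,\nabla\eta_{z'}\rangle\le0$ for the nodal hat functions of any two distinct nodes. Let $\mathcal V_h$ be the continuous, $\mathcal T_h$-piecewise affine functions $\overline\Omega\to\mathbb R^3$, $\mathcal M_h=\{n\in\mathcal V_h: |n(z)|=1\text{ for all nodes }z\}$, and $\mathcal K_n=\{\psi\in\mathcal V_h:\psi(z)\cdot n(z)=0\text{ for all nodes }z\}$. Given $m_h^0\in\mathcal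 M_h$, maps $\pi_h$ with values in $L^2(\Omega;\mathbb R^3)$, and $f_h\in L^2(\Omega;\mathbb R^3)$, compute for $i=0,\dots,N-1$ the function $v_h^i\in\mathcal K_{m_h^i}$ with $$\alpha\langle v_h^i,\psi\rangle+C_{\rm exch}k\theta\langle\nabla v_h^i,\nabla\psi\rangle+\langle m_h^i\times v_h^i,\psi\rangle=-C_{\rm exch}\langle\nabla m_h^i,\nabla\psi\rangle-\langle\pi_h(m_h^i),\psi\rangle+\langle f_h,\psi\rangle\quad\text{for all }\psi\in\mathcal K_{m_h^i},$$ and then $m_h^{i+1}\in\mathcal M_h$ by $m_h^{i+1}(z)=\dfrac{m_h^i(z)+kv_h^i(z)}{|m_h^i(z)+kv_h^i(z)|}$ for all nodes $z$. Let $m_{hk}^-(t)=m_h^i$ for $ik\le t<(i+1)k$. **Assumptions.** 1. $m_h^0\to m^0$ strongly in $H^1(\Omega)$. 2. There is $C>0$, independent of $h$ and $k$, with $\|\pi_h(n)\|_{L^2(\Omega)}\le C(1+\|\nabla n\|_{L^2(\Omega)})$ for all $n\in H^1(\Omega;\mathbb R^3)$ with $|n|\le1$ a.e. 3. $\pi:L^2(\Omega;\mathbb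 R^3)\to L^2(\Omega;\mathbb R^3)$ is linear, bounded and self-adjoint, and $\|\pi(w)\|_{L^4(\Omega)}\le C'\|w\|_{L^4(\Omega)}$ for all $w\in L^4(\Omega;\mathbb R^3)$, with a constant $C'$. 4. $f\in L^4(\Omega;\mathbb R^3)$ is independent of time, and $f_h\to f$ strongly in $L^2(\Omega)$. 5. $m$ is a limit of the scheme: along some subsequence, $m_{hk}^-\to m$ strongly in $L^2(\Omega_T)$ and $\pi_h(m_{hk}^-)\to\pi(m)$ strongly in $L^2(\Omega_T)$. **Conclusion.** Then $m\in H^1(\Omega_T)$ and, for almost every $t\in(0,T)$, $$\mathcal E(m(t))+\alpha\|\partial_t m\|_{L^2(\Omega_t)}^2\le\mathcal E(m^0),\qquad \mathcal E(u):=\frac{C_{\rm exch}}2\|\nabla u\|_{L^2(\Omega)}^2+\frac12\langle\pi(u),u\rangle-\langle f,u\rangle .$$ -/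

import Mathlib

open MeasureTheory Set Filter Topology
open scoped ENNReal NNReal ContDiff

noncomputable section

namespace LLG

/-- Physical space `ℝ³`, which is also the space of values of the magnetization, with the
Euclidean norm. -/
abbrev E3 := EuclideanSpace ℝ (Fin 3)

/-- The Hilbert space `𝑳²(Ω) = L²(Ω; ℝ³)`. -/
abbrev L2 (Ω : Set E3) := Lp E3 2 (volume.restrict Ω)

/-- The `j`-th canonical basis vector of `ℝ³`. -/
def basisVec (j : Fin 3) : E3 := EuclideanSpace.single j 1

/-- The vector product on `ℝ³`. -/
def cross (a b : E3) : E3 := WithLp.toLp 2 (crossProduct (WithLp.ofLp a) (WithLp.ofLp b))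

/-! ### Sobolev spaces -/

/-- `G = (∂₁u, ∂₂u, ∂₃u)` is the weak gradient on `Ω` of the vector field `u ∈ 𝑳²(Ω)`, with
`G j ∈ 𝑳²(Ω)`. Thus `u ∈ 𝑯¹(Ω)` if and only if such a `G` exists. -/
def HasWeakGradient (Ω : Set E3) (u : L2 Ω) (G : Fin 3 → L2 Ω) : Prop :=
  ∀ φ : E3 → ℝ, ContDiff ℝ ∞ φ → HasCompactSupport φ → tsupport φ ⊆ Ω → ∀ j : Fin 3,
    ∫ x in Ω, (fderiv ℝ φ x (basisVec j)) • u x = - ∫ x in Ω, φ x • G j x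

/-- `⟨∇u, ∇w⟩_Ω` for gradients `G = ∇u`, `H = ∇w`: the sum over all partial derivatives. -/
def gradInner {Ω : Set E3} (G H : Fin 3 → L2 Ω) : ℝ := ∑ j, inner ℝ (G j) (H j)

/-- `‖∇u‖_{𝑳²(Ω)}` for a gradient `G = ∇u`. -/
def gradNorm {Ω : Set E3} (G : Fin 3 → L2 Ω) : ℝ := Real.sqrt (∑ j, ‖G j‖ ^ 2)

/-- `v` is the weak time derivative on `(0,T)` of `m`, both with values in `𝑳²(Ω)`. For
`m, v ∈ L²(0,T; 𝑳²(Ω)) = 𝑳²((0,T) × Ω)` this is the distributional derivative `∂ₜm = v`. -/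
def HasWeakTimeDeriv {Ω : Set E3} (T : ℝ) (m v : ℝ → L2 Ω) : Prop :=
  ∀ φ : ℝ → ℝ, ContDiff ℝ ∞ φ → HasCompactSupport φ → tsupport φ ⊆ Ioo 0 T →
    ∫ t in Ioo 0 T, deriv φ t • m t = - ∫ t in Ioo 0 T, φ t • v t

/-- `m ∈ 𝑯¹((0,T) × Ω)` with spatial gradient `G` and time derivative `v`, all square integrable
over the space-time cylinder. -/
structure IsH1Cylinder (Ω : Set E3) (T : ℝ) (m : ℝ → L2 Ω) (G : ℝ → Fin 3 → L2 Ω)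
    (v : ℝ → L2 Ω) : Prop where
  memLp : MemLp m 2 (volume.restrict (Ioo 0 T))
  memLp_grad : ∀ j, MemLp (fun t => G t j) 2 (volume.restrict (Ioo 0 T))
  memLp_deriv : MemLp v 2 (volume.restrict (Ioo 0 T))
  hasWeakGradient : ∀ᵐ t ∂(volume.restrict (Ioo 0 T)), HasWeakGradient Ω (m t) (G t)
  hasWeakTimeDeriv : HasWeakTimeDeriv T m v

/-! ### Triangulations and lowest-order finite elements -/

/-- A conforming triangulation of `Ω` into finitely many tetrahedra, given as a simplicial complex
(two faces meet in a common face or not at all): every face belongs to a tetrahedron, and `Ω` is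
the interior of the union of the tetrahedra. -/
structure IsTriangulation (K : Geometry.SimplicialComplex ℝ E3) (Ω : Set E3) : Prop where
  finite : K.faces.Finite
  pure : ∀ s ∈ K.faces, ∃ t ∈ K.faces, s ⊆ t ∧ t.card = 4
  interior_space : interior K.space = Ω

/-- The tetrahedra of `K` are shape regular and have diameters comparable to `h`, both with the
constant `κ`. -/
structure IsQuasiUniform (K : Geometry.SimplicialComplex ℝ E3) (κ h : ℝ) : Prop where
  diam_le : ∀ s ∈ K.faces, s.card = 4 → Metric.diam (convexHull ℝ (s : Set E3)) ≤ κ * h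
  le_diam : ∀ s ∈ K.faces, s.card = 4 → h ≤ κ * Metric.diam (convexHull ℝ (s : Set E3))
  shape : ∀ s ∈ K.faces, s.card = 4 →
    Metric.diam (convexHull ℝ (s : Set E3)) ^ 3 ≤ κ * volume.real (convexHull ℝ (s : Set E3))

/-- Continuous functions on the triangulated set which are affine on every tetrahedron. (Values
outside the triangulated set play no role.) -/
def P1 (K : Geometry.SimplicialComplex ℝ E3) (F : Type*) [NormedAddCommGroup F]
    [NormedSpace ℝ F] : Set (E3 → F) :=
  {w | ContinuousOn w K.space ∧
    ∀ s ∈ K.faces, s.card = 4 → ∃ A : E3 →ᵃ[ℝ] F, EqOn w A (convexHull ℝ (s : Set E3))}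

/-- `η` is the nodal hat function of the node `z`. -/
def IsHat (K : Geometry.SimplicialComplex ℝ E3) (z : E3) (η : E3 → ℝ) : Prop :=
  η ∈ P1 K ℝ ∧ η z = 1 ∧ ∀ y ∈ K.vertices, y ≠ z → η y = 0

/-- The angle condition: `⟨∇η, ∇η'⟩_Ω ≤ 0` for the hat functions of any two distinct nodes. The
gradients are the classical ones, defined off the (null) union of the triangles. -/
def AngleCondition (Ω : Set E3) (K : Geometry.SimplicialComplex ℝ E3) : Prop :=
  ∀ z ∈ K.vertices, ∀ z' ∈ K.vertices, z ≠ z' → ∀ η η' : E3 → ℝ, IsHat K z η → IsHat K z' η' →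
    ∫ x in Ω, ∑ j, fderiv ℝ η x (basisVec j) * fderiv ℝ η' x (basisVec j) ≤ 0

/-- The discrete magnetizations: of unit length at every node. -/
def discreteMag (K : Geometry.SimplicialComplex ℝ E3) : Set (E3 → E3) :=
  {w | w ∈ P1 K E3 ∧ ∀ z ∈ K.vertices, ‖w z‖ = 1}

/-- The discrete tangent space at `m`: orthogonal to `m` at every node. -/
def tangentSpace (K : Geometry.SimplicialComplex ℝ E3) (m : E3 → E3) : Set (E3 → E3) :=
  {w | w ∈ P1 K E3 ∧ ∀ z ∈ K.vertices, inner ℝ (w z) (m z) = 0}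

open Classical in
/-- The class in `𝑳²(Ω)` of a square integrable function (`0` for any other function). It is applied
to piecewise affine functions, their gradients and products only. -/
def toL2 (Ω : Set E3) (w : E3 → E3) : L2 Ω :=
  if h : MemLp w 2 (volume.restrict Ω) then h.toLp w else 0

/-- The (a.e. classical) gradient of a piecewise affine function. -/
def discreteGrad (Ω : Set E3) (w : E3 → E3) : Fin 3 → L2 Ω :=
  fun j => toL2 Ω (fun x => fderiv ℝ w x (basisVec j))

/-! ### The linear-implicit integrator -/

/-- `(m i)` for `i ≤ N` and `(v i)` for `i < N` form an output of the linear-implicit tangent plane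
scheme with `N` steps of size `k` on the triangulation `K` of `Ω`, for the field
`C_exch Δm - π_h(m) + f_h` with a time-independent `f_h`. -/
structure IsSchemeOutput (Ω : Set E3) (K : Geometry.SimplicialComplex ℝ E3) (Cexch α θ k : ℝ)
    (N : ℕ) (pih : L2 Ω → L2 Ω) (fh : L2 Ω) (m v : ℕ → E3 → E3) : Prop where
  init_mem : m 0 ∈ discreteMag K
  v_mem : ∀ i < N, v i ∈ tangentSpace K (m i)
  variational : ∀ i < N, ∀ ψ ∈ tangentSpace K (m i),
    α * inner ℝ (toL2 Ω (v i)) (toL2 Ω ψ)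
      + Cexch * k * θ * gradInner (discreteGrad Ω (v i)) (discreteGrad Ω ψ)
      + inner ℝ (toL2 Ω (fun x => cross (m i x) (v i x))) (toL2 Ω ψ)
    = - Cexch * gradInner (discreteGrad Ω (m i)) (discreteGrad Ω ψ)
      - inner ℝ (pih (toL2 Ω (m i))) (toL2 Ω ψ)
      + inner ℝ fh (toL2 Ω ψ)
  m_mem : ∀ i < N, m (i + 1) ∈ discreteMag K
  update : ∀ i < N, ∀ z ∈ K.vertices,
    m (i + 1) z = ‖m i z + k • v i z‖⁻¹ • (m i z + k • v i z)

/-- The piecewise constant interpretation in time `γ⁻` of discrete values: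
`γ⁻(t) = γ i` for `i k ≤ t < (i + 1) k`. -/
def pwConst {X : Type*} (k : ℝ) (γ : ℕ → X) (t : ℝ) : X := γ ⌊t / k⌋₊

/-- The energy `C_exch/2 ‖∇u‖² + 1/2 ⟨π(u), u⟩ - ⟨f, u⟩` of `u ∈ 𝑯¹(Ω)` with `G = ∇u`. -/
def energy {Ω : Set E3} (Cexch : ℝ) (pi : L2 Ω →L[ℝ] L2 Ω) (f u : L2 Ω)
    (G : Fin 3 → L2 Ω) : ℝ :=
  Cexch / 2 * gradNorm G ^ 2 + 1 / 2 * inner ℝ (pi u) u - inner ℝ f u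

end LLG

end

namespace LLG

section Geometry

variable {K : Geometry.SimplicialComplex ℝ E3} {Ω : Set E3}

/-- The tetrahedra of a simplicial complex. -/
def tets (K : Geometry.SimplicialComplex ℝ E3) : Set (Finset E3) :=
  {s | s ∈ K.faces ∧ s.card = 4}

theorem tets_finite (hK : IsTriangulation K Ω) : (tets K).Finite :=
  hK.finite.subset fun _ hs => hs.1

theorem space_eq_tets (hK : IsTriangulation K Ω) :
    K.space = ⋃ s ∈ tets K, convexHull ℝ (s : Set E3) := by
  apply Subset.antisymm
  · intro x hx
    obtain ⟨s, hs, hxs⟩ := Geometry.SimplicialComplex.mem_space_iff.1 hx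
    obtain ⟨t, ht, hst, hc⟩ := hK.pure s hs
    exact mem_biUnion (show t ∈ tets K from ⟨ht, hc⟩)
      (convexHull_mono (Finset.coe_subset.2 hst) hxs)
  · exact iUnion₂_subset fun s hs => Geometry.SimplicialComplex.convexHull_subset_space hs.1

theorem exists_tet_of_mem_space (hK : IsTriangulation K Ω) {x : E3} (hx : x ∈ K.space) :
    ∃ s ∈ tets K, x ∈ convexHull ℝ (s : Set E3) := by
  rw [space_eq_tets hK] at hx
  simpa using hx

theorem isCompact_tet (s : Finset E3) : IsCompact (convexHull ℝ (s : Set E3)) :=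
  s.finite_toSet.isCompact_convexHull ℝ

theorem isCompact_space (hK : IsTriangulation K Ω) : IsCompact K.space := by
  rw [space_eq_tets hK]
  exact (tets_finite hK).isCompact_biUnion fun s _ => isCompact_tet s

theorem subset_space (hK : IsTriangulation K Ω) : Ω ⊆ K.space := by
  rw [← hK.interior_space]
  exact interior_subset

theorem vertices_finite (hK : IsTriangulation K Ω) : K.vertices.Finite := by
  rw [Geometry.SimplicialComplex.vertices_eq]
  exact hK.finite.biUnion fun s _ => s.finite_toSet

theorem mem_vertices_of_mem {s : Finset E3} (hs : s ∈ K.faces) {y : E3} (hy : y ∈ s) :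
    y ∈ K.vertices :=
  K.down_closed hs (Finset.singleton_subset_iff.2 hy) (Finset.singleton_nonempty y)

theorem exists_tet_of_vertex (hK : IsTriangulation K Ω) {z : E3} (hz : z ∈ K.vertices) :
    ∃ s ∈ tets K, z ∈ s := by
  obtain ⟨t, ht, hst, hc⟩ := hK.pure _ hz
  exact ⟨t, ⟨ht, hc⟩, hst (Finset.mem_singleton_self z)⟩

/-- Almost every point of the domain lies in the interior of a tetrahedron. -/
theorem ae_mem_interior_tet (hK : IsTriangulation K Ω) (hΩ : IsOpen Ω) :
    ∀ᵐ x ∂(volume.restrict Ω), ∃ s ∈ tets K, x ∈ interior (convexHull ℝ (s : Set E3)) := by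
  have h : ∀ᵐ x ∂(volume : Measure E3), ∀ s ∈ tets K,
      x ∉ frontier (convexHull ℝ (s : Set E3)) := by
    rw [ae_ball_iff (tets_finite hK).countable]
    intro s _
    exact measure_eq_zero_iff_ae_notMem.1 ((convex_convexHull ℝ (s : Set E3)).addHaar_frontier volume)
  filter_upwards [ae_restrict_of_ae h, ae_restrict_mem hΩ.measurableSet] with x hx hxΩ
  obtain ⟨s, hs, hxs⟩ := exists_tet_of_mem_space hK (subset_space hK hxΩ)
  refine ⟨s, hs, ?_⟩
  by_contra hn
  exact hx s hs ⟨subset_closure hxs, hn⟩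

/-- Affine functions with prescribed values at the vertices of a tetrahedron. -/
theorem exists_affine_of_tet {s : Finset E3} (hs : s ∈ tets K) (g : E3 → ℝ) :
    ∃ A : E3 →ᵃ[ℝ] ℝ, ∀ y ∈ s, A y = g y := by
  classical
  have hi : AffineIndependent ℝ ((↑) : s → E3) := K.indep hs.1
  have hspan : affineSpan ℝ (range ((↑) : s → E3)) = ⊤ := by
    rw [hi.affineSpan_eq_top_iff_card_eq_finrank_add_one]
    simp [hs.2]
  let b : AffineBasis s ℝ E3 := ⟨(↑), hi, hspan⟩
  refine ⟨∑ y : s, g y • b.coord y, fun y hy => ?_⟩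
  have h1 : ∀ t : Finset s, (∑ z ∈ t, g z • b.coord z) y = ∑ z ∈ t, g z * b.coord z y := by
    intro t
    induction t using Finset.induction_on with
    | empty => simp
    | insert a t ha ih => rw [Finset.sum_insert ha, Finset.sum_insert ha, ← ih]; simp
  rw [h1, Finset.sum_eq_single ⟨y, hy⟩]
  · have : b.coord ⟨y, hy⟩ (b ⟨y, hy⟩) = 1 := b.coord_apply_eq _
    have h2 : b ⟨y, hy⟩ = y := rfl
    rw [h2] at this
    simp [this]
  · intro z _ hz
    have : b.coord z (b ⟨y, hy⟩) = 0 := b.coord_apply_ne hz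
    have h2 : b ⟨y, hy⟩ = y := rfl
    rw [h2] at this
    simp [this]
  · simp

/-- Points of a simplex are convex combinations of its vertices. -/
theorem exists_weights {s : Finset E3} {x : E3} (hx : x ∈ convexHull ℝ (s : Set E3)) :
    ∃ c : E3 → ℝ, (∀ y ∈ s, 0 ≤ c y) ∧ ∑ y ∈ s, c y = 1 ∧ ∑ y ∈ s, c y • y = x := by
  obtain ⟨c, h0, h1, h2⟩ := Finset.mem_convexHull.1 hx
  refine ⟨c, h0, h1, ?_⟩
  rw [Finset.centerMass_eq_of_sum_1 _ _ h1] at h2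
  simpa using h2

theorem affineMap_apply_sum {F : Type*} [AddCommGroup F] [Module ℝ F] (A : E3 →ᵃ[ℝ] F)
    (s : Finset E3) {c : E3 → ℝ} (hc : ∑ y ∈ s, c y = 1) :
    A (∑ y ∈ s, c y • y) = ∑ y ∈ s, c y • A y := by
  have h1 := s.map_affineCombination (fun y => y) c hc A
  rw [Finset.affineCombination_eq_linear_combination _ _ _ hc,
    Finset.affineCombination_eq_linear_combination _ _ _ hc] at h1
  simpa using h1

/-- Piecewise affine functions on a tetrahedron in terms of barycentric coordinates. -/
theorem P1_apply_sum {F : Type*} [NormedAddCommGroup F] [NormedSpace ℝ F] {w : E3 → F}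
    (hw : w ∈ P1 K F) {s : Finset E3} (hs : s ∈ tets K) {c : E3 → ℝ} (h0 : ∀ y ∈ s, 0 ≤ c y)
    (hc : ∑ y ∈ s, c y = 1) : w (∑ y ∈ s, c y • y) = ∑ y ∈ s, c y • w y := by
  obtain ⟨A, hA⟩ := hw.2 s hs.1 hs.2
  have hm : ∑ y ∈ s, c y • y ∈ convexHull ℝ (s : Set E3) :=
    (convex_convexHull ℝ (s : Set E3)).sum_mem h0 hc
      fun y hy => subset_convexHull ℝ _ hy
  rw [hA hm, affineMap_apply_sum A s hc]
  exact Finset.sum_congr rfl fun y hy => by rw [hA (subset_convexHull ℝ _ hy)]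

/-- The nodal hat functions exist. -/
theorem exists_isHat (hK : IsTriangulation K Ω) {z : E3} (hz : z ∈ K.vertices) :
    ∃ η : E3 → ℝ, IsHat K z η := by
  classical
  have hL : ∀ s : Finset E3, ∃ A : E3 →ᵃ[ℝ] ℝ, s ∈ tets K →
      ∀ y ∈ s, A y = if y = z then 1 else 0 := by
    intro s
    by_cases hs : s ∈ tets K
    · obtain ⟨A, hA⟩ := exists_affine_of_tet hs fun y => if y = z then 1 else 0
      exact ⟨A, fun _ => hA⟩
    · exact ⟨0, fun h => absurd h hs⟩
  choose L hL using hL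
  have hcons : ∀ s ∈ tets K, ∀ t ∈ tets K, ∀ x, x ∈ convexHull ℝ (s : Set E3) →
      x ∈ convexHull ℝ (t : Set E3) → L s x = L t x := by
    intro s hs t ht x hxs hxt
    have hx : x ∈ convexHull ℝ ((s ∩ t : Finset E3) : Set E3) := by
      rw [Finset.coe_inter]
      exact K.inter_subset_convexHull hs.1 ht.1 ⟨hxs, hxt⟩
    obtain ⟨c, -, hc, rfl⟩ := exists_weights hx
    rw [affineMap_apply_sum _ _ hc, affineMap_apply_sum _ _ hc]
    refine Finset.sum_congr rfl fun y hy => ?_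
    rw [hL s hs y (Finset.mem_inter.1 hy).1, hL t ht y (Finset.mem_inter.1 hy).2]
  have hη : ∃ η : E3 → ℝ, ∀ s ∈ tets K, EqOn η (L s) (convexHull ℝ (s : Set E3)) := by
    refine ⟨fun x => if h : ∃ s ∈ tets K, x ∈ convexHull ℝ (s : Set E3) then L h.choose x else 0,
      fun s hs x hx => ?_⟩
    have h : ∃ s ∈ tets K, x ∈ convexHull ℝ (s : Set E3) := ⟨s, hs, hx⟩
    simp only [h, dif_pos]
    exact hcons _ h.choose_spec.1 _ hs x h.choose_spec.2 hx
  obtain ⟨η, hη⟩ := hη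
  have hval : ∀ y ∈ K.vertices, η y = if y = z then 1 else 0 := by
    intro y hy
    obtain ⟨s, hs, hys⟩ := exists_tet_of_vertex hK hy
    rw [hη s hs (subset_convexHull ℝ _ hys), hL s hs y hys]
  refine ⟨η, ⟨?_, fun s hs hc => ⟨L s, hη s ⟨hs, hc⟩⟩⟩, by simp [hval z hz], fun y hy hne => by
    simp [hval y hy, hne]⟩
  have hf : Finite (tets K) := (tets_finite hK)
  rw [space_eq_tets hK, biUnion_eq_iUnion]
  refine (locallyFinite_of_finite _).continuousOn_iUnion
    (fun s => (isCompact_tet (s : Finset E3)).isClosed) fun s => ?_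
  exact (AffineMap.continuous_of_finiteDimensional (L s)).continuousOn.congr (hη s s.2)

/-- The barycentric weights are the values of the hat functions. -/
theorem hat_apply_sum {η : E3 → ℝ} {z : E3} (hη : IsHat K z η) {s : Finset E3} (hs : s ∈ tets K)
    {c : E3 → ℝ} (h0 : ∀ y ∈ s, 0 ≤ c y) (hc : ∑ y ∈ s, c y = 1) [Decidable (z ∈ s)] :
    η (∑ y ∈ s, c y • y) = if z ∈ s then c z else 0 := by
  rw [P1_apply_sum hη.1 hs h0 hc]
  split_ifs with h
  · rw [Finset.sum_eq_single z]
    · simp [hη.2.1]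
    · intro y hy hne
      simp [hη.2.2 y (mem_vertices_of_mem hs.1 hy) hne]
    · exact fun h' => absurd h h'
  · refine Finset.sum_eq_zero fun y hy => ?_
    have hne : y ≠ z := fun e => h (e ▸ hy)
    simp [hη.2.2 y (mem_vertices_of_mem hs.1 hy) hne]

/-- Expansion of a piecewise affine function in the nodal basis. -/
theorem nodal_expansion (hK : IsTriangulation K Ω) {V : Finset E3} (hV : (V : Set E3) = K.vertices)
    {η : E3 → E3 → ℝ} (hη : ∀ z ∈ V, IsHat K z (η z))
    {F : Type*} [NormedAddCommGroup F] [NormedSpace ℝ F] {w : E3 → F}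
    (hw : w ∈ P1 K F) {x : E3} (hx : x ∈ K.space) :
    w x = ∑ z ∈ V, η z x • w z := by
  classical
  obtain ⟨s, hs, hxs⟩ := exists_tet_of_mem_space hK hx
  obtain ⟨c, h0, hc, rfl⟩ := exists_weights hxs
  have hsV : s ⊆ V := fun y hy => by
    have := mem_vertices_of_mem hs.1 hy
    rw [← hV] at this
    exact this
  rw [P1_apply_sum hw hs h0 hc, ← Finset.sum_subset hsV]
  · refine Finset.sum_congr rfl fun y hy => ?_
    rw [hat_apply_sum (hη y (hsV hy)) hs h0 hc, if_pos hy]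
  · intro y hy hys
    rw [hat_apply_sum (hη y hy) hs h0 hc, if_neg hys, zero_smul]

end Geometry

/-- A pointwise Lipschitz estimate with a uniform constant implies a global one. -/
theorem lipschitzWith_of_eventually {E F : Type*} [NormedAddCommGroup E] [NormedSpace ℝ E]
    [NormedAddCommGroup F] {f : E → F} {L : ℝ≥0}
    (h : ∀ x, ∀ᶠ y in 𝓝 x, ‖f y - f x‖ ≤ L * ‖y - x‖) : LipschitzWith L f := by
  have hcont : Continuous f := by
    rw [continuous_iff_continuousAt]
    intro x
    rw [ContinuousAt, tendsto_iff_norm_sub_tendsto_zero]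
    have h0 : Tendsto (fun y => (L : ℝ) * ‖y - x‖) (𝓝 x) (𝓝 0) := by
      have : Continuous fun y => (L : ℝ) * ‖y - x‖ := by fun_prop
      simpa using this.tendsto x
    exact squeeze_zero' (Eventually.of_forall fun y => norm_nonneg _) (h x) h0
  refine LipschitzWith.of_dist_le_mul fun y x => ?_
  rw [dist_eq_norm, dist_eq_norm]
  refine le_of_forall_pos_le_add fun ε hε => ?_
  set c : ℝ → E := fun t => x + t • (y - x) with hc
  have hcc : Continuous c := by fun_prop
  have key := image_norm_le_of_liminf_right_slope_norm_lt_deriv_boundary (a := 0) (b := 1)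
    (f := fun t => f (c t) - f x) (f' := fun _ => L * ‖y - x‖)
    (by fun_prop) (B := fun t => (L * ‖y - x‖ + ε) * t) (B' := fun _ => L * ‖y - x‖ + ε)
    ?_ (by simp [hc]) (by fun_prop) ?_ ?_
  · have := key (x := 1) (by simp)
    simpa [hc] using this
  · intro t _ r hr
    refine Eventually.frequently ?_
    have h1 : ∀ᶠ z in 𝓝[>] t, ‖f (c z) - f (c t)‖ ≤ L * ‖c z - c t‖ :=
      (hcc.tendsto t).eventually (h (c t)) |>.filter_mono nhdsWithin_le_nhds
    filter_upwards [h1, self_mem_nhdsWithin] with z hz hzt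
    have hzt' : 0 < z - t := sub_pos.2 hzt
    refine lt_of_le_of_lt ?_ hr
    rw [slope_def_field, div_le_iff₀ hzt']
    have h2 : c z - c t = (z - t) • (y - x) := by simp only [hc]; module
    have h3 := norm_sub_norm_le (f (c z) - f x) (f (c t) - f x)
    rw [sub_sub_sub_cancel_right] at h3
    rw [h2, norm_smul, Real.norm_of_nonneg hzt'.le] at hz
    simp only [Function.comp]
    linarith
  · intro t _
    simpa using ((hasDerivAt_id t).const_mul (L * ‖y - x‖ + ε)).hasDerivWithinAt
  · intro t _ _
    linarith

section Analysis

variable {K : Geometry.SimplicialComplex ℝ E3} {Ω : Set E3}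
variable {F : Type*} [NormedAddCommGroup F] [NormedSpace ℝ F]

theorem isFiniteMeasure_restrict (hK : IsTriangulation K Ω) :
    IsFiniteMeasure (volume.restrict Ω) := by
  have : volume Ω < ⊤ :=
    (measure_mono (subset_space hK)).trans_lt (isCompact_space hK).measure_lt_top
  exact ⟨by simpa using this⟩

theorem P1_add_smul {u w : E3 → F} (hu : u ∈ P1 K F) (hw : w ∈ P1 K F) (c : ℝ) :
    (fun x => u x + c • w x) ∈ P1 K F := by
  refine ⟨hu.1.add (hw.1.const_smul c), fun s hs hc => ?_⟩
  obtain ⟨A, hA⟩ := hu.2 s hs hc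
  obtain ⟨B, hB⟩ := hw.2 s hs hc
  exact ⟨A + c • B, fun x hx => by simp [hA hx, hB hx]⟩

theorem P1_const (c : F) : (fun _ => c) ∈ P1 K F :=
  ⟨continuousOn_const, fun _ _ _ => ⟨AffineMap.const ℝ E3 c, fun _ _ => rfl⟩⟩

theorem P1_bounded (hK : IsTriangulation K Ω) {w : E3 → F} (hw : w ∈ P1 K F) :
    ∃ B : ℝ, 0 ≤ B ∧ ∀ x ∈ K.space, ‖w x‖ ≤ B := by
  obtain ⟨B, hB⟩ := (isCompact_space hK).exists_bound_of_continuousOn hw.1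
  exact ⟨max B 0, le_max_right _ _, fun x hx => (hB x hx).trans (le_max_left _ _)⟩

/-- Derivatives and difference quotients of piecewise affine functions. -/
theorem P1_linear_parts {w : E3 → F} (hK : IsTriangulation K Ω) (hw : w ∈ P1 K F) :
    ∃ L : ℝ≥0, ∀ s ∈ tets K, ∃ A : E3 →L[ℝ] F, ‖A‖ ≤ L ∧
      (∀ x ∈ interior (convexHull ℝ (s : Set E3)), HasFDerivAt w A x) ∧
      ∀ x ∈ convexHull ℝ (s : Set E3), ∀ y ∈ convexHull ℝ (s : Set E3),
        w y - w x = A (y - x) := by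
  have h : ∀ s : Finset E3, ∃ A : E3 →L[ℝ] F, s ∈ tets K →
      (∀ x ∈ interior (convexHull ℝ (s : Set E3)), HasFDerivAt w A x) ∧
      ∀ x ∈ convexHull ℝ (s : Set E3), ∀ y ∈ convexHull ℝ (s : Set E3),
        w y - w x = A (y - x) := by
    intro s
    by_cases hs : s ∈ tets K
    · obtain ⟨A, hA⟩ := hw.2 s hs.1 hs.2
      have hL : ∀ x y, A y - A x = LinearMap.toContinuousLinearMap A.linear (y - x) := by
        intro x y
        have := A.linearMap_vsub y x
        simpa using this.symm
      refine ⟨LinearMap.toContinuousLinearMap A.linear, fun _ => ⟨fun x hx => ?_, fun x hx y hy => ?_⟩⟩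
      · have h1 : HasFDerivAt A (LinearMap.toContinuousLinearMap A.linear) x := by
          have h2 : (A : E3 → F) = fun y => LinearMap.toContinuousLinearMap A.linear y + A 0 := by
            ext y
            have := hL 0 y
            rw [sub_zero] at this
            rw [← this, sub_add_cancel]
          rw [h2]
          exact (ContinuousLinearMap.hasFDerivAt _).add_const _
        refine h1.congr_of_eventuallyEq ?_
        filter_upwards [mem_interior_iff_mem_nhds.1 hx] with y hy using hA hy
      · rw [hA hx, hA hy, hL]
    · exact ⟨0, fun h => absurd h hs⟩
  choose A hA using h
  obtain ⟨L, hL⟩ := ((tets_finite hK).image fun s => ‖A s‖₊).bddAbove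
  exact ⟨L, fun s hs => ⟨A s, by exact_mod_cast hL ⟨s, hs, rfl⟩, (hA s hs).1, (hA s hs).2⟩⟩

theorem P1_ae_differentiableAt (hK : IsTriangulation K Ω) (hΩ : IsOpen Ω) {w : E3 → F}
    (hw : w ∈ P1 K F) :
    ∃ L : ℝ≥0, ∀ᵐ x ∂(volume.restrict Ω), DifferentiableAt ℝ w x ∧ ‖fderiv ℝ w x‖ ≤ L := by
  obtain ⟨L, hL⟩ := P1_linear_parts hK hw
  refine ⟨L, ?_⟩
  filter_upwards [ae_mem_interior_tet hK hΩ] with x ⟨s, hs, hx⟩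
  obtain ⟨A, hAL, hA, -⟩ := hL s hs
  exact ⟨(hA x hx).differentiableAt, by rw [(hA x hx).fderiv]; exact hAL⟩

/-- The pointwise Lipschitz estimate for piecewise affine functions. -/
theorem P1_eventually_lipschitz (hK : IsTriangulation K Ω) (hΩ : IsOpen Ω) {w : E3 → F}
    (hw : w ∈ P1 K F) :
    ∃ L : ℝ≥0, ∀ x ∈ Ω, ∀ᶠ y in 𝓝 x, ‖w y - w x‖ ≤ L * ‖y - x‖ := by
  obtain ⟨L, hL⟩ := P1_linear_parts hK hw
  refine ⟨L, fun x hx => ?_⟩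
  have h1 : ∀ᶠ y in 𝓝 x, ∀ s ∈ tets K, x ∉ convexHull ℝ (s : Set E3) →
      y ∉ convexHull ℝ (s : Set E3) := by
    rw [(tets_finite hK).eventually_all]
    intro s _
    by_cases h : x ∈ convexHull ℝ (s : Set E3)
    · exact Eventually.of_forall fun y h' => absurd h h'
    · filter_upwards [(isCompact_tet s).isClosed.isOpen_compl.mem_nhds h] with y hy _ using hy
  filter_upwards [h1, hΩ.mem_nhds hx] with y hy hyΩ
  obtain ⟨s, hs, hys⟩ := exists_tet_of_mem_space hK (subset_space hK hyΩ)
  have hxs : x ∈ convexHull ℝ (s : Set E3) := by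
    by_contra hn
    exact hy s hs hn hys
  obtain ⟨A, hAL, -, hA⟩ := hL s hs
  rw [hA x hxs y hys]
  exact (A.le_opNorm _).trans (by gcongr)

theorem P1_aestronglyMeasurable (hK : IsTriangulation K Ω) (hΩ : IsOpen Ω)
    {w : E3 → F} (hw : w ∈ P1 K F) : AEStronglyMeasurable w (volume.restrict Ω) :=
  (hw.1.mono (subset_space hK)).aestronglyMeasurable hΩ.measurableSet

theorem P1_memLp (hK : IsTriangulation K Ω) (hΩ : IsOpen Ω) {w : E3 → F}
    (hw : w ∈ P1 K F) (p : ℝ≥0∞) : MemLp w p (volume.restrict Ω) := by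
  have := isFiniteMeasure_restrict hK
  obtain ⟨B, -, hB⟩ := P1_bounded hK hw
  refine MemLp.of_bound (P1_aestronglyMeasurable hK hΩ hw) B ?_
  filter_upwards [ae_restrict_mem hΩ.measurableSet] with x hx using hB x (subset_space hK hx)

theorem P1_fderiv_memLp [CompleteSpace F] [MeasurableSpace F] [BorelSpace F]
    [SecondCountableTopology F] (hK : IsTriangulation K Ω) (hΩ : IsOpen Ω) {w : E3 → F}
    (hw : w ∈ P1 K F) (e : E3) (p : ℝ≥0∞) :
    MemLp (fun x => fderiv ℝ w x e) p (volume.restrict Ω) := by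
  have := isFiniteMeasure_restrict hK
  obtain ⟨B, hB⟩ := P1_ae_differentiableAt hK hΩ hw
  refine MemLp.of_bound (measurable_fderiv_apply_const ℝ w e).aestronglyMeasurable (B * ‖e‖) ?_
  filter_upwards [hB] with x hx
  exact (ContinuousLinearMap.le_opNorm _ _).trans (by gcongr; exact hx.2)

end Analysis

section L2

variable {K : Geometry.SimplicialComplex ℝ E3} {Ω : Set E3}

theorem coeFn_toL2 {w : E3 → E3} (hw : MemLp w 2 (volume.restrict Ω)) :
    toL2 Ω w =ᵐ[volume.restrict Ω] w := by
  rw [toL2, dif_pos hw]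
  exact hw.coeFn_toLp

theorem toL2_eq_of_ae {u : E3 → E3} {w : L2 Ω} (h : u =ᵐ[volume.restrict Ω] w) :
    toL2 Ω u = w := by
  have hu : MemLp u 2 (volume.restrict Ω) := (memLp_congr_ae h).2 (Lp.memLp w)
  exact Lp.ext ((coeFn_toL2 hu).trans h)

theorem coeFn_toL2_P1 (hK : IsTriangulation K Ω) (hΩ : IsOpen Ω) {w : E3 → E3}
    (hw : w ∈ P1 K E3) : toL2 Ω w =ᵐ[volume.restrict Ω] w :=
  coeFn_toL2 (P1_memLp hK hΩ hw 2)

theorem coeFn_discreteGrad (hK : IsTriangulation K Ω) (hΩ : IsOpen Ω) {w : E3 → E3}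
    (hw : w ∈ P1 K E3) (j : Fin 3) :
    discreteGrad Ω w j =ᵐ[volume.restrict Ω] fun x => fderiv ℝ w x (basisVec j) :=
  coeFn_toL2 (P1_fderiv_memLp hK hΩ hw _ 2)

theorem toL2_add_smul (hK : IsTriangulation K Ω) (hΩ : IsOpen Ω) {u w : E3 → E3}
    (hu : u ∈ P1 K E3) (hw : w ∈ P1 K E3) (c : ℝ) :
    toL2 Ω (fun x => u x + c • w x) = toL2 Ω u + c • toL2 Ω w := by
  apply toL2_eq_of_ae
  filter_upwards [coeFn_toL2_P1 hK hΩ hu, coeFn_toL2_P1 hK hΩ hw,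
    Lp.coeFn_add (toL2 Ω u) (c • toL2 Ω w), Lp.coeFn_smul c (toL2 Ω w)] with x h1 h2 h3 h4
  rw [h3, Pi.add_apply, h4, Pi.smul_apply, h1, h2]

theorem discreteGrad_add_smul (hK : IsTriangulation K Ω) (hΩ : IsOpen Ω) {u w : E3 → E3}
    (hu : u ∈ P1 K E3) (hw : w ∈ P1 K E3) (c : ℝ) :
    discreteGrad Ω (fun x => u x + c • w x) = discreteGrad Ω u + c • discreteGrad Ω w := by
  funext j
  apply toL2_eq_of_ae
  obtain ⟨_, hdu⟩ := P1_ae_differentiableAt hK hΩ hu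
  obtain ⟨_, hdw⟩ := P1_ae_differentiableAt hK hΩ hw
  filter_upwards [coeFn_discreteGrad hK hΩ hu j, coeFn_discreteGrad hK hΩ hw j,
    Lp.coeFn_add (discreteGrad Ω u j) (c • discreteGrad Ω w j),
    Lp.coeFn_smul c (discreteGrad Ω w j), hdu, hdw] with x h1 h2 h3 h4 h5 h6
  rw [Pi.add_apply, Pi.smul_apply, h3, Pi.add_apply, h4, Pi.smul_apply, h1, h2]
  have : HasFDerivAt (fun x => u x + c • w x) (fderiv ℝ u x + c • fderiv ℝ w x) x :=
    h5.1.hasFDerivAt.add (h6.1.hasFDerivAt.const_smul c)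
  rw [this.fderiv]
  rfl

/-- The integral of a partial derivative of a compactly supported Lipschitz function vanishes. -/
theorem integral_lineDeriv_eq_zero {u : E3 → ℝ} {L : ℝ≥0} (hu : LipschitzWith L u)
    (hc : HasCompactSupport u) (e : E3) : ∫ x, lineDeriv ℝ u x e = 0 := by
  have h := (LipschitzWith.const (1 : ℝ) : LipschitzWith 0 fun _ : E3 => (1 : ℝ)).integral_lineDeriv_mul_eq
    (μ := volume) hu hc (-e)
  have h0 : ∀ x : E3, lineDeriv ℝ (fun _ : E3 => (1 : ℝ)) x (-e) = 0 := fun x => by simp [lineDeriv]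
  simpa [h0] using h.symm

/-- Piecewise affine functions are weakly differentiable. -/
theorem hasWeakGradient_P1 (hK : IsTriangulation K Ω) (hΩ : IsOpen Ω) {w : E3 → E3}
    (hw : w ∈ P1 K E3) : HasWeakGradient Ω (toL2 Ω w) (discreteGrad Ω w) := by
  intro φ hφ hφc hφΩ j
  have hfin := isFiniteMeasure_restrict hK
  set e := basisVec j with he
  obtain ⟨Cφ, hCφ⟩ := ContDiff.lipschitzWith_of_hasCompactSupport hφc hφ (by simp)
  obtain ⟨Bφ, hBφ⟩ := hφc.exists_bound_of_continuous hφ.continuous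
  have hBφ0 : 0 ≤ Bφ := (norm_nonneg _).trans (hBφ 0)
  obtain ⟨Lw, hLw⟩ := P1_eventually_lipschitz hK hΩ hw
  obtain ⟨Bw, hBw0, hBw⟩ := P1_bounded hK hw
  obtain ⟨_, hdw⟩ := P1_ae_differentiableAt hK hΩ hw
  have hdφ : Continuous fun x => fderiv ℝ φ x e :=
    (hφ.continuous_fderiv (by simp)).clm_apply continuous_const
  have hdφc : HasCompactSupport fun x => fderiv ℝ φ x e := hφc.fderiv_apply ℝ e
  obtain ⟨Bd, hBd⟩ := hdφc.exists_bound_of_continuous hdφ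
  have i1 : Integrable (fun x => fderiv ℝ φ x e • w x) (volume.restrict Ω) :=
    ((P1_memLp hK hΩ hw 1).integrable le_rfl).bdd_smul Bd hdφ.aestronglyMeasurable
      (Eventually.of_forall hBd)
  have i2 : Integrable (fun x => φ x • fderiv ℝ w x e) (volume.restrict Ω) :=
    ((P1_fderiv_memLp hK hΩ hw e 1).integrable le_rfl).bdd_smul Bφ
      hφ.continuous.aestronglyMeasurable (Eventually.of_forall hBφ)
  have e1 : ∫ x in Ω, fderiv ℝ φ x e • toL2 Ω w x = ∫ x in Ω, fderiv ℝ φ x e • w x :=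
    integral_congr_ae (by filter_upwards [coeFn_toL2_P1 hK hΩ hw] with x hx; rw [hx])
  have e2 : ∫ x in Ω, φ x • discreteGrad Ω w j x = ∫ x in Ω, φ x • fderiv ℝ w x e :=
    integral_congr_ae (by filter_upwards [coeFn_discreteGrad hK hΩ hw j] with x hx; rw [hx])
  rw [e1, e2, eq_neg_iff_add_eq_zero, ← integral_add i1 i2]
  ext i
  set P : E3 →L[ℝ] ℝ := EuclideanSpace.proj i with hP
  change P (∫ x in Ω, ((fun x => fderiv ℝ φ x e • w x) + fun x => φ x • fderiv ℝ w x e) x) = _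
  rw [← P.integral_comp_comm (i1.add i2)]
  set u : E3 → ℝ := fun x => φ x * P (w x) with hu
  have hPn : ∀ y : E3, |P y| ≤ ‖y‖ := fun y => by
    simpa [hP] using PiLp.norm_apply_le y i
  have hulip : LipschitzWith (Real.toNNReal (Bφ * Lw + Cφ * Bw)) u := by
    apply lipschitzWith_of_eventually
    intro x
    rw [Real.coe_toNNReal _ (by positivity)]
    by_cases hx : x ∈ Ω
    · filter_upwards [hLw x hx] with y hy
      have h1 : u y - u x = φ y * P (w y - w x) + (φ y - φ x) * P (w x) := by
        simp only [hu, map_sub]; ring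
      have h2 : |φ y - φ x| ≤ Cφ * ‖y - x‖ := by
        have := hCφ.dist_le_mul y x
        rwa [Real.dist_eq, dist_eq_norm] at this
      have h3 : |P (w x)| ≤ Bw := (hPn _).trans (hBw x (subset_space hK hx))
      calc ‖u y - u x‖ ≤ |φ y * P (w y - w x)| + |(φ y - φ x) * P (w x)| := by
            rw [h1]; exact abs_add_le _ _
        _ = |φ y| * |P (w y - w x)| + |φ y - φ x| * |P (w x)| := by rw [abs_mul, abs_mul]
        _ ≤ Bφ * (Lw * ‖y - x‖) + Cφ * ‖y - x‖ * Bw := by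
            gcongr
            · exact hBφ y
            · exact (hPn _).trans hy
        _ = _ := by ring
    · have hx' : x ∉ tsupport φ := fun h => hx (hφΩ h)
      have h0 : φ =ᶠ[𝓝 x] 0 := notMem_tsupport_iff_eventuallyEq.1 hx'
      filter_upwards [h0] with y hy
      have : u y - u x = 0 := by simp [hu, hy, h0.self_of_nhds]
      rw [this, norm_zero]
      positivity
  have huc : HasCompactSupport u := hφc.mul_right
  have h0 := integral_lineDeriv_eq_zero hulip huc e
  rw [← setIntegral_eq_integral_of_forall_compl_eq_zero (s := Ω)] at h0
  · rw [PiLp.zero_apply, ← h0]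
    refine integral_congr_ae ?_
    filter_upwards [hdw] with x hx
    have h1 : HasFDerivAt u (φ x • (P.comp (fderiv ℝ w x)) + P (w x) • fderiv ℝ φ x) x :=
      ((hφ.differentiable (by simp)) x).hasFDerivAt.mul (P.hasFDerivAt.comp x hx.1.hasFDerivAt)
    rw [(h1.hasLineDerivAt e).lineDeriv]
    simp
    ring
  · intro x hx
    have hx' : x ∉ tsupport φ := fun h => hx (hφΩ h)
    have h0 : φ =ᶠ[𝓝 x] 0 := notMem_tsupport_iff_eventuallyEq.1 hx'
    have h1 : u =ᶠ[𝓝 x] fun _ => 0 := by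
      filter_upwards [h0] with y hy
      simp [hu, hy]
    rw [h1.lineDeriv_eq]
    simp [lineDeriv]

end L2

section Stiffness

/-- A quadratic form with vanishing row sums in terms of differences. -/
theorem sum_inner_eq_neg_half {ι H : Type*} [NormedAddCommGroup H] [InnerProductSpace ℝ H]
    (V : Finset ι) {a : ι → ι → ℝ} (hs : ∀ z ∈ V, ∀ z' ∈ V, a z z' = a z' z)
    (h0 : ∀ z ∈ V, ∑ z' ∈ V, a z z' = 0) (w : ι → H) :
    ∑ z ∈ V, ∑ z' ∈ V, a z z' * inner ℝ (w z) (w z')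
      = -(1 / 2) * ∑ z ∈ V, ∑ z' ∈ V, a z z' * ‖w z - w z'‖ ^ 2 := by
  have h1 : ∑ z ∈ V, ∑ z' ∈ V, a z z' * ‖w z‖ ^ 2 = 0 :=
    Finset.sum_eq_zero fun z hz => by rw [← Finset.sum_mul, h0 z hz, zero_mul]
  have h2 : ∑ z ∈ V, ∑ z' ∈ V, a z z' * ‖w z'‖ ^ 2 = 0 := by
    rw [Finset.sum_comm]
    refine Finset.sum_eq_zero fun z hz => ?_
    rw [← Finset.sum_mul, Finset.sum_congr rfl fun z' hz' => hs z' hz' z hz, h0 z hz, zero_mul]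
  have h3 : ∑ z ∈ V, ∑ z' ∈ V, a z z' * ‖w z - w z'‖ ^ 2
      = ∑ z ∈ V, ∑ z' ∈ V, a z z' * ‖w z‖ ^ 2
        - 2 * ∑ z ∈ V, ∑ z' ∈ V, a z z' * inner ℝ (w z) (w z')
        + ∑ z ∈ V, ∑ z' ∈ V, a z z' * ‖w z'‖ ^ 2 := by
    simp only [Finset.mul_sum, ← Finset.sum_sub_distrib, ← Finset.sum_add_distrib]
    refine Finset.sum_congr rfl fun z _ => Finset.sum_congr rfl fun z' _ => ?_
    rw [norm_sub_sq_real]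
    ring
  rw [h3, h1, h2]
  ring

theorem sum_inner_le_of_norm_sub_le {ι H : Type*} [NormedAddCommGroup H] [InnerProductSpace ℝ H]
    (V : Finset ι) {a : ι → ι → ℝ} (hs : ∀ z ∈ V, ∀ z' ∈ V, a z z' = a z' z)
    (h0 : ∀ z ∈ V, ∑ z' ∈ V, a z z' = 0) (ha : ∀ z ∈ V, ∀ z' ∈ V, z ≠ z' → a z z' ≤ 0)
    {u w : ι → H} (huw : ∀ z ∈ V, ∀ z' ∈ V, ‖u z - u z'‖ ≤ ‖w z - w z'‖) :
    ∑ z ∈ V, ∑ z' ∈ V, a z z' * inner ℝ (u z) (u z')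
      ≤ ∑ z ∈ V, ∑ z' ∈ V, a z z' * inner ℝ (w z) (w z') := by
  rw [sum_inner_eq_neg_half V hs h0, sum_inner_eq_neg_half V hs h0]
  have : ∑ z ∈ V, ∑ z' ∈ V, a z z' * ‖w z - w z'‖ ^ 2
      ≤ ∑ z ∈ V, ∑ z' ∈ V, a z z' * ‖u z - u z'‖ ^ 2 := by
    refine Finset.sum_le_sum fun z hz => Finset.sum_le_sum fun z' hz' => ?_
    by_cases h : z = z'
    · simp [h]
    · exact mul_le_mul_of_nonpos_left (pow_le_pow_left₀ (norm_nonneg _) (huw z hz z' hz') 2)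
        (ha z hz z' hz' h)
  linarith

variable {K : Geometry.SimplicialComplex ℝ E3} {Ω : Set E3}

/-- Gradients in the nodal basis. -/
theorem ae_fderiv_expansion (hK : IsTriangulation K Ω) (hΩ : IsOpen Ω) {V : Finset E3}
    (hV : (V : Set E3) = K.vertices) {η : E3 → E3 → ℝ} (hη : ∀ z ∈ V, IsHat K z (η z))
    {F : Type*} [NormedAddCommGroup F] [NormedSpace ℝ F] {w : E3 → F} (hw : w ∈ P1 K F) :
    ∀ᵐ x ∂(volume.restrict Ω), ∀ e : E3,
      fderiv ℝ w x e = ∑ z ∈ V, fderiv ℝ (η z) x e • w z := by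
  have hd : ∀ᵐ x ∂(volume.restrict Ω), ∀ z ∈ V, DifferentiableAt ℝ (η z) x := by
    rw [Finset.eventually_all]
    intro z hz
    obtain ⟨_, h⟩ := P1_ae_differentiableAt hK hΩ (hη z hz).1
    exact h.mono fun x hx => hx.1
  filter_upwards [hd, ae_restrict_mem hΩ.measurableSet] with x hx hxΩ e
  have h1 : w =ᶠ[𝓝 x] fun y => ∑ z ∈ V, η z y • w z := by
    filter_upwards [hΩ.mem_nhds hxΩ] with y hy
    exact nodal_expansion hK hV hη hw (subset_space hK hy)
  have h2 : HasFDerivAt (fun y => ∑ z ∈ V, η z y • w z)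
      (∑ z ∈ V, (fderiv ℝ (η z) x).smulRight (w z)) x :=
    HasFDerivAt.fun_sum fun z hz => (hx z hz).hasFDerivAt.smul_const (w z)
  rw [(h2.congr_of_eventuallyEq h1).fderiv]
  simp

/-- Under the angle condition the Dirichlet energy is monotone with respect to the differences of
the nodal values. -/
theorem gradNorm_sq_le_of_nodal (hK : IsTriangulation K Ω) (hΩ : IsOpen Ω)
    (ha : AngleCondition Ω K) {u w : E3 → E3} (hu : u ∈ P1 K E3) (hw : w ∈ P1 K E3)
    (huw : ∀ z ∈ K.vertices, ∀ z' ∈ K.vertices, ‖u z - u z'‖ ≤ ‖w z - w z'‖) :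
    gradInner (discreteGrad Ω u) (discreteGrad Ω u)
      ≤ gradInner (discreteGrad Ω w) (discreteGrad Ω w) := by
  classical
  obtain ⟨V, hV⟩ : ∃ V : Finset E3, (V : Set E3) = K.vertices :=
    ⟨(vertices_finite hK).toFinset, by simp⟩
  have hVm : ∀ z, z ∈ V ↔ z ∈ K.vertices := fun z => by rw [← hV]; simp
  have hη : ∀ z, ∃ η : E3 → ℝ, z ∈ V → IsHat K z η := by
    intro z
    by_cases hz : z ∈ V
    · obtain ⟨η, h⟩ := exists_isHat hK ((hVm z).1 hz)
      exact ⟨η, fun _ => h⟩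
    · exact ⟨0, fun h => absurd h hz⟩
  choose η hη using hη
  have hint : ∀ z ∈ V, ∀ z' ∈ V, ∀ j : Fin 3, Integrable
      (fun x => fderiv ℝ (η z) x (basisVec j) * fderiv ℝ (η z') x (basisVec j))
      (volume.restrict Ω) := fun z hz z' hz' j =>
    (P1_fderiv_memLp hK hΩ (hη z hz).1 _ 2).integrable_mul (P1_fderiv_memLp hK hΩ (hη z' hz').1 _ 2)
  set a : E3 → E3 → ℝ := fun z z' =>
    ∫ x in Ω, ∑ j, fderiv ℝ (η z) x (basisVec j) * fderiv ℝ (η z') x (basisVec j) with ha_def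
  have ha_eq : ∀ z ∈ V, ∀ z' ∈ V, a z z' = ∑ j : Fin 3,
      ∫ x in Ω, fderiv ℝ (η z) x (basisVec j) * fderiv ℝ (η z') x (basisVec j) :=
    fun z hz z' hz' => integral_finsetSum _ fun j _ => hint z hz z' hz' j
  have hform : ∀ w ∈ P1 K E3, gradInner (discreteGrad Ω w) (discreteGrad Ω w)
      = ∑ z ∈ V, ∑ z' ∈ V, a z z' * inner ℝ (w z) (w z') := by
    intro w hw
    have h1 : ∀ j : Fin 3, inner ℝ (discreteGrad Ω w j) (discreteGrad Ω w j)
        = ∑ z ∈ V, ∑ z' ∈ V, (∫ x in Ω, fderiv ℝ (η z) x (basisVec j)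
          * fderiv ℝ (η z') x (basisVec j)) * inner ℝ (w z) (w z') := by
      intro j
      rw [MeasureTheory.L2.inner_def]
      have h2 : ∫ x in Ω, inner ℝ (discreteGrad Ω w j x) (discreteGrad Ω w j x)
          = ∫ x in Ω, ∑ z ∈ V, ∑ z' ∈ V, (fderiv ℝ (η z) x (basisVec j)
            * fderiv ℝ (η z') x (basisVec j)) * inner ℝ (w z) (w z') := by
        refine integral_congr_ae ?_
        filter_upwards [coeFn_discreteGrad hK hΩ hw j, ae_fderiv_expansion hK hΩ hV hη hw]
          with x hx1 hx2
        rw [hx1, hx2, sum_inner]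
        refine Finset.sum_congr rfl fun z _ => ?_
        rw [inner_sum]
        refine Finset.sum_congr rfl fun z' _ => ?_
        rw [real_inner_smul_left, real_inner_smul_right]
        ring
      rw [h2, integral_finsetSum]
      · refine Finset.sum_congr rfl fun z hz => ?_
        rw [integral_finsetSum]
        · exact Finset.sum_congr rfl fun z' _ => integral_mul_const _ _
        · exact fun z' hz' => (hint z hz z' hz' j).mul_const _
      · exact fun z hz => integrable_finsetSum _ fun z' hz' => (hint z hz z' hz' j).mul_const _
    simp only [gradInner, h1]
    rw [Finset.sum_comm]
    refine Finset.sum_congr rfl fun z hz => ?_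
    rw [Finset.sum_comm]
    refine Finset.sum_congr rfl fun z' hz' => ?_
    rw [ha_eq z hz z' hz', Finset.sum_mul]
  rw [hform u hu, hform w hw]
  refine sum_inner_le_of_norm_sub_le V ?_ ?_ ?_ fun z hz z' hz' =>
    huw z ((hVm z).1 hz) z' ((hVm z').1 hz')
  · intro z _ z' _
    simp only [ha_def, mul_comm]
  · intro z hz
    rw [Finset.sum_congr rfl fun z' hz' => ha_eq z hz z' hz', Finset.sum_comm]
    refine Finset.sum_eq_zero fun j _ => ?_
    rw [← integral_finsetSum _ fun z' hz' => hint z hz z' hz' j]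
    refine integral_eq_zero_of_ae ?_
    filter_upwards [ae_fderiv_expansion hK hΩ hV hη (P1_const (K := K) (1 : ℝ))] with x hx
    have := hx (basisVec j)
    simp only [fderiv_fun_const, smul_eq_mul, mul_one] at this
    rw [← Finset.mul_sum, ← this]
    simp
  · exact fun z hz z' hz' hne => ha z ((hVm z).1 hz) z' ((hVm z').1 hz') hne _ _ (hη z hz) (hη z' hz')

end Stiffness

section Lumping

/-- The value of an affine function at a point of a convex body is controlled by its mean square. -/
theorem affine_sq_le_integral {S : Set E3} (hS : IsCompact S) (hSc : Convex ℝ S)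
    (A : E3 →ᵃ[ℝ] E3) {z : E3} (hz : z ∈ S) :
    volume.real S * ‖A z‖ ^ 2 ≤ 66 * ∫ x in S, ‖A x‖ ^ 2 := by
  have hAc : Continuous A := AffineMap.continuous_of_finiteDimensional A
  set T : E3 → E3 := fun x => z + (1 / 2 : ℝ) • (x - z) with hT
  have hTS : T '' S ⊆ S := by
    rintro _ ⟨x, hx, rfl⟩
    exact hSc.add_smul_sub_mem hz hx (by norm_num)
  have hAT : ∀ x, A (T x) = (1 / 2 : ℝ) • A z + (1 / 2 : ℝ) • A x := by
    intro x
    have : T x = AffineMap.lineMap z x (1 / 2 : ℝ) := by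
      simp [hT, AffineMap.lineMap_apply, add_comm]
    rw [this, AffineMap.apply_lineMap, AffineMap.lineMap_apply]
    simp only [vsub_eq_sub, vadd_eq_add]
    module
  have hint : ∀ g : E3 → ℝ, Continuous g → IntegrableOn g S := fun g hg =>
    hg.continuousOn.integrableOn_compact hS
  have hcv : ∫ x in T '' S, ‖A x‖ ^ 2 = (1 / 8) * ∫ x in S, ‖A (T x)‖ ^ 2 := by
    have hT' : ∀ x ∈ S, HasFDerivWithinAt T ((1 / 2 : ℝ) • ContinuousLinearMap.id ℝ E3) S x := by
      intro x _
      exact ((((hasFDerivAt_id x).sub_const z).const_smul (1 / 2 : ℝ)).const_add z).hasFDerivWithinAt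
    have hinj : InjOn T S := by
      intro x _ y _ hxy
      have h := add_left_cancel hxy
      have h' := smul_right_injective E3 (by norm_num : (1 / 2 : ℝ) ≠ 0) h
      exact sub_left_injective h'
    have hdet : ((1 / 2 : ℝ) • ContinuousLinearMap.id ℝ E3).det = 1 / 8 := by
      rw [ContinuousLinearMap.det]
      have : (((1 / 2 : ℝ) • ContinuousLinearMap.id ℝ E3 : E3 →L[ℝ] E3) : E3 →ₗ[ℝ] E3)
          = (1 / 2 : ℝ) • LinearMap.id := rfl
      rw [this, LinearMap.det_smul]
      simp
      norm_num
    rw [integral_image_eq_integral_abs_det_fderiv_smul volume hS.measurableSet hT' hinj, hdet]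
    rw [← integral_const_mul]
    norm_num
  have hTc : Continuous T := by fun_prop
  have hpt : ∀ x, 1 / 4 * ‖A z‖ ^ 2 ≤ 2 * ‖A (T x)‖ ^ 2 + 1 / 2 * ‖A x‖ ^ 2 := by
    intro x
    have h1 : (1 / 2 : ℝ) • A z = A (T x) - (1 / 2 : ℝ) • A x := by rw [hAT]; module
    have h2 := norm_sub_le (A (T x)) ((1 / 2 : ℝ) • A x)
    rw [← h1, norm_smul, norm_smul] at h2
    norm_num at h2
    nlinarith [norm_nonneg (A z), norm_nonneg (A (T x)), norm_nonneg (A x),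
      sq_nonneg (‖A (T x)‖ - 1 / 2 * ‖A x‖)]
  have h1 : ∫ _ in S, 1 / 4 * ‖A z‖ ^ 2 ≤ ∫ x in S, (2 * ‖A (T x)‖ ^ 2 + 1 / 2 * ‖A x‖ ^ 2) :=
    integral_mono (hint _ continuous_const) (hint _ (by fun_prop)) hpt
  have i1 : IntegrableOn (fun x => 2 * ‖A (T x)‖ ^ 2) S := hint _ (by fun_prop)
  have i2 : IntegrableOn (fun x => 1 / 2 * ‖A x‖ ^ 2) S := hint _ (by fun_prop)
  rw [integral_add i1 i2, integral_const_mul, integral_const_mul, integral_const_mul, setIntegral_const,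
    smul_eq_mul] at h1
  have h2 : ∫ x in T '' S, ‖A x‖ ^ 2 ≤ ∫ x in S, ‖A x‖ ^ 2 :=
    setIntegral_mono_set (hint _ (by fun_prop)) (Eventually.of_forall fun x => by positivity)
      hTS.eventuallyLE
  rw [hcv] at h2
  linarith

variable {K : Geometry.SimplicialComplex ℝ E3} {Ω : Set E3}

theorem disjoint_interior_tets {s t : Finset E3} (hs : s ∈ tets K) (ht : t ∈ tets K)
    (hst : s ≠ t) :
    Disjoint (interior (convexHull ℝ (s : Set E3))) (interior (convexHull ℝ (t : Set E3))) := by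
  classical
  rw [disjoint_iff_inter_eq_empty]
  by_contra hne
  have ho : IsOpen (interior (convexHull ℝ (s : Set E3)) ∩ interior (convexHull ℝ (t : Set E3))) :=
    isOpen_interior.inter isOpen_interior
  have hpos := ho.measure_pos volume (nonempty_iff_ne_empty.2 hne)
  have hsub : interior (convexHull ℝ (s : Set E3)) ∩ interior (convexHull ℝ (t : Set E3))
      ⊆ affineSpan ℝ ((s ∩ t : Finset E3) : Set E3) := by
    refine (inter_subset_inter interior_subset interior_subset).trans ?_
    refine (K.inter_subset_convexHull hs.1 ht.1).trans ?_
    rw [Finset.coe_inter]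
    exact convexHull_subset_affineSpan _
  have hcard : (s ∩ t).card < 4 := by
    rw [← hs.2]
    refine Finset.card_lt_card (Finset.ssubset_iff_subset_ne.2 ⟨Finset.inter_subset_left, fun h => ?_⟩)
    have h1 : s ⊆ t := Finset.inter_eq_left.1 h
    exact hst (Finset.eq_of_subset_of_card_le h1 (by rw [hs.2, ht.2]))
  have htop : affineSpan ℝ ((s ∩ t : Finset E3) : Set E3) ≠ ⊤ := by
    intro h
    by_cases hn : (s ∩ t).Nonempty
    · have h1 : (s ∩ t).card = ((s ∩ t).card - 1) + 1 := by
        have := hn.card_pos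
        omega
      have h2 := finrank_vectorSpan_image_finset_le ℝ (id : E3 → E3) (s ∩ t) h1
      rw [Finset.image_id] at h2
      rw [← direction_affineSpan, h, AffineSubspace.direction_top, finrank_top] at h2
      simp at h2
      omega
    · rw [Finset.not_nonempty_iff_eq_empty] at hn
      rw [hn] at h
      simp at h
  have h0 := Measure.addHaar_affineSubspace (volume : Measure E3) _ htop
  exact hpos.ne' (measure_mono_null hsub h0)

/-- Integrals over the domain are sums over the tetrahedra. -/
theorem integral_eq_sum_tets (hK : IsTriangulation K Ω) (hΩ : IsOpen Ω) {S : Finset (Finset E3)}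
    (hS : (S : Set (Finset E3)) = tets K) {g : E3 → ℝ} (hg : IntegrableOn g Ω) :
    ∫ x in Ω, g x = ∑ s ∈ S, ∫ x in convexHull ℝ (s : Set E3), g x := by
  have hmem : ∀ s, s ∈ S ↔ s ∈ tets K := fun s => by rw [← hS]; simp
  have hsub : ∀ s ∈ S, interior (convexHull ℝ (s : Set E3)) ⊆ Ω := fun s hs => by
    rw [← hK.interior_space]
    exact interior_mono (Geometry.SimplicialComplex.convexHull_subset_space ((hmem s).1 hs).1)
  have h1 : Ω =ᵐ[volume] ⋃ s ∈ S, interior (convexHull ℝ (s : Set E3)) := by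
    refine Filter.EventuallyLE.antisymm ?_ (LE.le.eventuallyLE (iUnion₂_subset hsub))
    filter_upwards [(ae_restrict_iff' hΩ.measurableSet).1 (ae_mem_interior_tet hK hΩ)] with x hx hxΩ
    obtain ⟨s, hs, h⟩ := hx hxΩ
    exact mem_biUnion ((hmem s).2 hs) h
  rw [setIntegral_congr_set h1, integral_biUnion_finset]
  · refine Finset.sum_congr rfl fun s _ => setIntegral_congr_set ?_
    exact interior_ae_eq_of_null_frontier ((convex_convexHull ℝ (s : Set E3)).addHaar_frontier volume)
  · exact fun s _ => isOpen_interior.measurableSet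
  · exact fun s hs t ht hst => disjoint_interior_tets ((hmem s).1 hs) ((hmem t).1 ht) hst
  · exact fun s hs => hg.mono_set (hsub s hs)

/-- Mass lumping: a nodal quadratic bound implies an `L¹` bound. -/
theorem integral_norm_le_of_nodal (hK : IsTriangulation K Ω) (hΩ : IsOpen Ω) {e v : E3 → E3}
    (he : e ∈ P1 K E3) (hv : v ∈ P1 K E3) {c : ℝ} (hc : 0 ≤ c)
    (hev : ∀ z ∈ K.vertices, ‖e z‖ ≤ c * ‖v z‖ ^ 2) :
    ∫ x in Ω, ‖e x‖ ≤ 66 * c * ∫ x in Ω, ‖v x‖ ^ 2 := by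
  obtain ⟨S, hS⟩ : ∃ S : Finset (Finset E3), (S : Set (Finset E3)) = tets K :=
    ⟨(tets_finite hK).toFinset, by simp⟩
  have := isFiniteMeasure_restrict hK
  have i1 : IntegrableOn (fun x => ‖e x‖) Ω := ((P1_memLp hK hΩ he 1).integrable le_rfl).norm
  have i2 : IntegrableOn (fun x => ‖v x‖ ^ 2) Ω := (P1_memLp hK hΩ hv 2).integrable_norm_pow (by simp)
  rw [integral_eq_sum_tets hK hΩ hS i1, integral_eq_sum_tets hK hΩ hS i2, Finset.mul_sum]
  refine Finset.sum_le_sum fun s hs => ?_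
  have hs : s ∈ tets K := by rw [← hS]; simpa using hs
  obtain ⟨A, hA⟩ := hv.2 s hs.1 hs.2
  have hvA : ∫ x in convexHull ℝ (s : Set E3), ‖v x‖ ^ 2
      = ∫ x in convexHull ℝ (s : Set E3), ‖A x‖ ^ 2 :=
    setIntegral_congr_fun (isCompact_tet s).measurableSet fun x hx => by simp only [hA hx]
  set I := ∫ x in convexHull ℝ (s : Set E3), ‖v x‖ ^ 2 with hI
  have hI0 : 0 ≤ I := integral_nonneg fun x => by positivity
  set μs := volume.real (convexHull ℝ (s : Set E3)) with hμs
  have hpt : ∀ x ∈ convexHull ℝ (s : Set E3), μs * ‖e x‖ ≤ 66 * c * I := by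
    intro x hx
    obtain ⟨b, hb0, hb1, rfl⟩ := exists_weights hx
    rw [P1_apply_sum he hs hb0 hb1]
    calc μs * ‖∑ y ∈ s, b y • e y‖ ≤ μs * ∑ y ∈ s, b y * (c * ‖v y‖ ^ 2) := by
          gcongr
          refine (norm_sum_le _ _).trans (Finset.sum_le_sum fun y hy => ?_)
          rw [norm_smul, Real.norm_of_nonneg (hb0 y hy)]
          exact mul_le_mul_of_nonneg_left (hev y (mem_vertices_of_mem hs.1 hy)) (hb0 y hy)
      _ = ∑ y ∈ s, b y * (c * (μs * ‖v y‖ ^ 2)) := by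
          rw [Finset.mul_sum]
          exact Finset.sum_congr rfl fun y _ => by ring
      _ ≤ ∑ y ∈ s, b y * (c * (66 * I)) := by
          refine Finset.sum_le_sum fun y hy => ?_
          have hys := subset_convexHull ℝ (s : Set E3) hy
          have := affine_sq_le_integral (isCompact_tet s) (convex_convexHull ℝ _) A hys
          rw [← hvA, ← hA hys] at this
          exact mul_le_mul_of_nonneg_left (mul_le_mul_of_nonneg_left this hc) (hb0 y hy)
      _ = 66 * c * I := by
          rw [← Finset.sum_mul, hb1]
          ring
  rcases (measureReal_nonneg : 0 ≤ μs).eq_or_lt with h0 | hpos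
  · have : volume (convexHull ℝ (s : Set E3)) = 0 :=
      (measureReal_eq_zero_iff (isCompact_tet s).measure_lt_top.ne).1 h0.symm
    rw [setIntegral_measure_zero _ this]
    positivity
  · have hb : ∀ x ∈ convexHull ℝ (s : Set E3), ‖‖e x‖‖ ≤ 66 * c * I / μs := fun x hx => by
      rw [norm_norm, le_div_iff₀ hpos, mul_comm]
      exact hpt x hx
    have h1 := norm_setIntegral_le_of_norm_le_const (μ := volume)
      (isCompact_tet s).measure_lt_top hb
    rw [div_mul_cancel₀ _ hpos.ne'] at h1
    exact (le_abs_self _).trans h1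

end Lumping

section GradInner

variable {Ω : Set E3}

theorem gradInner_add_smul_self (G H : Fin 3 → L2 Ω) (c : ℝ) :
    gradInner (G + c • H) (G + c • H)
      = gradInner G G + 2 * c * gradInner G H + c ^ 2 * gradInner H H := by
  simp only [gradInner, Finset.mul_sum, ← Finset.sum_add_distrib]
  refine Finset.sum_congr rfl fun j _ => ?_
  simp only [Pi.add_apply, Pi.smul_apply, inner_add_left, inner_add_right, real_inner_smul_left,
    real_inner_smul_right]
  rw [real_inner_comm (G j) (H j)]
  ring

theorem gradInner_self_nonneg (G : Fin 3 → L2 Ω) : 0 ≤ gradInner G G :=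
  Finset.sum_nonneg fun _ _ => real_inner_self_nonneg

theorem gradInner_self (G : Fin 3 → L2 Ω) : gradInner G G = ∑ j, ‖G j‖ ^ 2 :=
  Finset.sum_congr rfl fun _ _ => real_inner_self_eq_norm_sq _

theorem gradNorm_eq_sqrt (G : Fin 3 → L2 Ω) : gradNorm G = √(gradInner G G) := by
  rw [gradNorm, gradInner_self]

theorem gradNorm_sq (G : Fin 3 → L2 Ω) : gradNorm G ^ 2 = gradInner G G := by
  rw [gradNorm_eq_sqrt, Real.sq_sqrt (gradInner_self_nonneg G)]

end GradInner

/-- The radial projection onto the sphere does not increase distances outside of the unit ball. -/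
theorem norm_normalize_sub_le {H : Type*} [NormedAddCommGroup H] [InnerProductSpace ℝ H] {p q : H}
    (hp : 1 ≤ ‖p‖) (hq : 1 ≤ ‖q‖) : ‖‖p‖⁻¹ • p - ‖q‖⁻¹ • q‖ ≤ ‖p - q‖ := by
  have hp0 : 0 < ‖p‖ := by linarith
  have hq0 : 0 < ‖q‖ := by linarith
  rw [← sq_le_sq₀ (norm_nonneg _) (norm_nonneg _), norm_sub_sq_real, norm_sub_sq_real, norm_smul,
    norm_smul, norm_inv, norm_norm, norm_inv, norm_norm, inv_mul_cancel₀ hp0.ne',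
    inv_mul_cancel₀ hq0.ne', real_inner_smul_left, real_inner_smul_right]
  set t := ‖p‖⁻¹ * (‖q‖⁻¹ * inner ℝ p q) with ht
  have h1 : inner ℝ p q = ‖p‖ * ‖q‖ * t := by
    rw [ht]
    field_simp
  have h2 : t ≤ 1 := by
    have := real_inner_le_norm p q
    rw [h1] at this
    have hpq : 0 < ‖p‖ * ‖q‖ := mul_pos hp0 hq0
    nlinarith
  rw [h1]
  have hpq : 1 ≤ ‖p‖ * ‖q‖ := one_le_mul_of_one_le_of_one_le hp hq
  nlinarith [sq_nonneg (‖p‖ - ‖q‖), mul_nonneg (sub_nonneg.2 hpq) (sub_nonneg.2 h2)]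

theorem inner_cross_right (a b : E3) : inner ℝ (cross a b) b = 0 := by
  simp [cross, crossProduct, PiLp.inner_apply, Fin.sum_univ_three]
  ring

theorem norm_cross_le (a b : E3) : ‖cross a b‖ ≤ ‖a‖ * ‖b‖ := by
  rw [← sq_le_sq₀ (norm_nonneg _) (by positivity), mul_pow, EuclideanSpace.norm_sq_eq,
    EuclideanSpace.norm_sq_eq, EuclideanSpace.norm_sq_eq]
  simp [cross, crossProduct, Fin.sum_univ_three]
  nlinarith [sq_nonneg (a 0 * b 0 + a 1 * b 1 + a 2 * b 2)]

theorem continuous_cross : Continuous fun p : E3 × E3 => cross p.1 p.2 := by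
  refine (PiLp.continuous_toLp 2 _).comp (continuous_pi fun i => ?_)
  fin_cases i <;> simp [crossProduct] <;> fun_prop

section Scheme

variable {Ω : Set E3} {K : Geometry.SimplicialComplex ℝ E3} {Cexch α θ k : ℝ} {N : ℕ}
  {pih : L2 Ω → L2 Ω} {fh : L2 Ω} {m v : ℕ → E3 → E3}

theorem discreteMag_norm_le (hK : IsTriangulation K Ω) {w : E3 → E3} (hw : w ∈ discreteMag K)
    {x : E3} (hx : x ∈ K.space) : ‖w x‖ ≤ 1 := by
  obtain ⟨s, hs, hxs⟩ := exists_tet_of_mem_space hK hx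
  obtain ⟨b, hb0, hb1, rfl⟩ := exists_weights hxs
  rw [P1_apply_sum hw.1 hs hb0 hb1, ← hb1]
  refine (norm_sum_le _ _).trans (Finset.sum_le_sum fun y hy => ?_)
  rw [norm_smul, hw.2 y (mem_vertices_of_mem hs.1 hy), mul_one, Real.norm_of_nonneg (hb0 y hy)]

theorem inner_toL2_cross_self (hK : IsTriangulation K Ω) (hΩ : IsOpen Ω) {a b : E3 → E3}
    (ha : a ∈ P1 K E3) (hb : b ∈ P1 K E3) :
    inner ℝ (toL2 Ω fun x => cross (a x) (b x)) (toL2 Ω b) = 0 := by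
  have := isFiniteMeasure_restrict hK
  obtain ⟨A, hA0, hA⟩ := P1_bounded hK ha
  have hm : MemLp (fun x => cross (a x) (b x)) 2 (volume.restrict Ω) := by
    refine MemLp.of_le_mul (g := b) (c := A) (P1_memLp hK hΩ hb 2)
      (continuous_cross.comp_aestronglyMeasurable
        ((P1_aestronglyMeasurable hK hΩ ha).prodMk (P1_aestronglyMeasurable hK hΩ hb))) ?_
    filter_upwards [ae_restrict_mem hΩ.measurableSet] with x hx
    exact (norm_cross_le _ _).trans (by gcongr; exact hA x (subset_space hK hx))
  rw [MeasureTheory.L2.inner_def]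
  refine integral_eq_zero_of_ae ?_
  filter_upwards [coeFn_toL2 hm, coeFn_toL2_P1 hK hΩ hb] with x h1 h2
  rw [h1, h2, inner_cross_right]
  rfl

theorem IsSchemeOutput.mem_discreteMag (hS : IsSchemeOutput Ω K Cexch α θ k N pih fh m v) :
    ∀ {i : ℕ}, i ≤ N → m i ∈ discreteMag K
  | 0, _ => hS.init_mem
  | i + 1, hi => hS.m_mem i hi

theorem IsSchemeOutput.norm_update (hS : IsSchemeOutput Ω K Cexch α θ k N pih fh m v) {i : ℕ}
    (hi : i < N) {z : E3} (hz : z ∈ K.vertices) :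
    ‖m i z + k • v i z‖ ^ 2 = 1 + k ^ 2 * ‖v i z‖ ^ 2 := by
  rw [norm_add_sq_real, (hS.mem_discreteMag hi.le).2 z hz, real_inner_smul_right, real_inner_comm,
    (hS.v_mem i hi).2 z hz, norm_smul, mul_pow, Real.norm_eq_abs, sq_abs]
  ring

theorem IsSchemeOutput.one_le_norm_update (hS : IsSchemeOutput Ω K Cexch α θ k N pih fh m v)
    {i : ℕ} (hi : i < N) {z : E3} (hz : z ∈ K.vertices) : 1 ≤ ‖m i z + k • v i z‖ := by
  have h := hS.norm_update hi hz
  by_contra! hlt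
  nlinarith [norm_nonneg (m i z + k • v i z), mul_nonneg (sq_nonneg k) (sq_nonneg ‖v i z‖)]

/-- One step of the discrete energy inequality. -/
theorem IsSchemeOutput.energy_step (hK : IsTriangulation K Ω) (hΩ : IsOpen Ω)
    (ha : AngleCondition Ω K) (hS : IsSchemeOutput Ω K Cexch α θ k N pih fh m v)
    (hC : 0 < Cexch) (hθ : 1 / 2 < θ) {i : ℕ} (hi : i < N) :
    Cexch / 2 * gradInner (discreteGrad Ω (m (i + 1))) (discreteGrad Ω (m (i + 1)))
        + k * (α * ‖toL2 Ω (v i)‖ ^ 2)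
      ≤ Cexch / 2 * gradInner (discreteGrad Ω (m i)) (discreteGrad Ω (m i))
        + k * inner ℝ (fh - pih (toL2 Ω (m i))) (toL2 Ω (v i)) := by
  have hm := (hS.mem_discreteMag hi.le).1
  have hv := (hS.v_mem i hi).1
  have h1 := hS.variational i hi (v i) (hS.v_mem i hi)
  rw [inner_toL2_cross_self hK hΩ hm hv, real_inner_self_eq_norm_sq] at h1
  have h2 := gradNorm_sq_le_of_nodal hK hΩ ha (hS.m_mem i hi).1 (P1_add_smul hm hv k)
    fun z hz z' hz' => by
      rw [hS.update i hi z hz, hS.update i hi z' hz']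
      exact norm_normalize_sub_le (hS.one_le_norm_update hi hz) (hS.one_le_norm_update hi hz')
  rw [discreteGrad_add_smul hK hΩ hm hv, gradInner_add_smul_self] at h2
  rw [inner_sub_left]
  have h3 : 0 ≤ Cexch * (θ - 1 / 2) * k ^ 2
      * gradInner (discreteGrad Ω (v i)) (discreteGrad Ω (v i)) :=
    mul_nonneg (mul_nonneg (mul_nonneg hC.le (by linarith)) (sq_nonneg k)) (gradInner_self_nonneg _)
  have h4 := mul_le_mul_of_nonneg_left h2 (by positivity : 0 ≤ Cexch / 2)
  have h5 := congrArg (fun r => k * r) h1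
  linarith

/-- The discrete energy inequality. -/
theorem IsSchemeOutput.energy_sum (hK : IsTriangulation K Ω) (hΩ : IsOpen Ω)
    (ha : AngleCondition Ω K) (hS : IsSchemeOutput Ω K Cexch α θ k N pih fh m v)
    (hC : 0 < Cexch) (hθ : 1 / 2 < θ) {j : ℕ} (hj : j ≤ N) :
    Cexch / 2 * gradInner (discreteGrad Ω (m j)) (discreteGrad Ω (m j))
        + ∑ i ∈ Finset.range j, k * (α * ‖toL2 Ω (v i)‖ ^ 2)
      ≤ Cexch / 2 * gradInner (discreteGrad Ω (m 0)) (discreteGrad Ω (m 0))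
        + ∑ i ∈ Finset.range j, k * inner ℝ (fh - pih (toL2 Ω (m i))) (toL2 Ω (v i)) := by
  induction j with
  | zero => simp
  | succ j ih =>
    rw [Finset.sum_range_succ, Finset.sum_range_succ]
    have h1 := hS.energy_step hK hΩ ha hC hθ hj
    have h2 := ih (Nat.le_of_succ_le hj)
    linarith

/-- The discrepancy between the discrete time derivative and `v`. -/
theorem IsSchemeOutput.integral_increment_le (hK : IsTriangulation K Ω) (hΩ : IsOpen Ω)
    (hS : IsSchemeOutput Ω K Cexch α θ k N pih fh m v) {i : ℕ} (hi : i < N) :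
    ∫ x in Ω, ‖(toL2 Ω (m (i + 1)) - toL2 Ω (m i) - k • toL2 Ω (v i)) x‖
      ≤ 33 * k ^ 2 * ‖toL2 Ω (v i)‖ ^ 2 := by
  have hm := (hS.mem_discreteMag hi.le).1
  have hm' := (hS.m_mem i hi).1
  have hv := (hS.v_mem i hi).1
  have he := P1_add_smul hm' (P1_add_smul hm hv k) (-1)
  have h1 : toL2 Ω (m (i + 1)) - toL2 Ω (m i) - k • toL2 Ω (v i)
      = toL2 Ω fun x => m (i + 1) x + (-1 : ℝ) • (m i x + k • v i x) := by
    rw [toL2_add_smul hK hΩ hm' (P1_add_smul hm hv k), toL2_add_smul hK hΩ hm hv]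
    module
  have h2 : ∫ x in Ω, ‖v i x‖ ^ 2 = ‖toL2 Ω (v i)‖ ^ 2 := by
    rw [← real_inner_self_eq_norm_sq, MeasureTheory.L2.inner_def]
    refine integral_congr_ae ?_
    filter_upwards [coeFn_toL2_P1 hK hΩ hv] with x hx
    rw [hx, real_inner_self_eq_norm_sq]
  have h3 := integral_norm_le_of_nodal hK hΩ he hv (c := k ^ 2 / 2) (by positivity) ?_
  · rw [h1, ← h2]
    calc _ = ∫ x in Ω, ‖m (i + 1) x + (-1 : ℝ) • (m i x + k • v i x)‖ :=
          integral_congr_ae (by filter_upwards [coeFn_toL2_P1 hK hΩ he] with x hx; rw [hx])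
      _ ≤ _ := h3
      _ = _ := by ring
  · intro z hz
    have h4 := hS.norm_update hi hz
    have h5 := hS.one_le_norm_update hi hz
    set p := m i z + k • v i z with hp
    have h6 : m (i + 1) z + (-1 : ℝ) • p = (‖p‖⁻¹ - 1) • p := by
      rw [hS.update i hi z hz]
      module
    have h7 : ‖p‖⁻¹ ≤ 1 := inv_le_one_of_one_le₀ h5
    rw [h6, norm_smul, Real.norm_of_nonpos (by linarith)]
    have h8 : -(‖p‖⁻¹ - 1) * ‖p‖ = ‖p‖ - 1 := by
      have : ‖p‖ ≠ 0 := by linarith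
      field_simp
      ring
    rw [h8]
    nlinarith [sq_nonneg (‖p‖ - 1)]

end Scheme

/-- A discrete Gronwall estimate with quadratic dissipation. -/
theorem gronwall_dissipation {C α k F P : ℝ} (hC : 0 < C) (hα : 0 < α) (hk : 0 ≤ k)
    {N : ℕ} {a b : ℕ → ℝ} (ha : ∀ i, 0 ≤ a i) 
    (h : ∀ i < N, C / 2 * a (i + 1) + k * (α * b i ^ 2)
      ≤ C / 2 * a i + k * ((F + P * (1 + √(a i))) * b i)) {j : ℕ} (hj : j ≤ N) :
    C / 2 * a j + α / 2 * ∑ i ∈ Finset.range j, k * b i ^ 2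
      ≤ (C / 2 * a 0 + j * k * ((F + P) ^ 2 / α)) * Real.exp (j * k * (2 * P ^ 2 / (α * C))) := by
  induction j with
  | zero => simp
  | succ j ih =>
    have ih := ih (Nat.le_of_succ_le hj)
    have h1 := h j hj
    rw [Finset.sum_range_succ]
    set E := C / 2 * a j + α / 2 * ∑ i ∈ Finset.range j, k * b i ^ 2 with hE
    set B₁ := (F + P) ^ 2 / α with hB₁
    set B₂ := 2 * P ^ 2 / (α * C) with hB₂
    have hB₁0 : 0 ≤ B₁ := by positivity
    have hB₂0 : 0 ≤ B₂ := by positivity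
    have hyoung : (F + P * (1 + √(a j))) * b j ≤ α / 2 * b j ^ 2 + (B₁ + P ^ 2 / α * a j) := by
      have hs : √(a j) ^ 2 = a j := Real.sq_sqrt (ha j)
      have e1 : B₁ + P ^ 2 / α * a j = ((F + P) ^ 2 + P ^ 2 * √(a j) ^ 2) / α := by
        rw [hB₁, hs]; ring
      rw [e1, ← sub_nonneg]
      have e2 : α / 2 * b j ^ 2 + ((F + P) ^ 2 + P ^ 2 * √(a j) ^ 2) / α
          - (F + P * (1 + √(a j))) * b j
          = ((α * b j - (F + P + P * √(a j))) ^ 2 + (F + P - P * √(a j)) ^ 2) / (2 * α) := by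
        field_simp
        ring
      rw [e2]
      positivity
    have hsum : 0 ≤ ∑ i ∈ Finset.range j, k * b i ^ 2 :=
      Finset.sum_nonneg fun i _ => by positivity
    have hPa : P ^ 2 / α * a j ≤ B₂ * E := by
      have e1 : P ^ 2 / α * a j = B₂ * (C / 2 * a j) := by
        rw [hB₂]
        field_simp
      rw [e1, hE]
      have : 0 ≤ α / 2 * ∑ i ∈ Finset.range j, k * b i ^ 2 := by positivity
      gcongr
      linarith
    have hE0 : 0 ≤ E := by
      have := ha j
      positivity
    have hstep : C / 2 * a (j + 1) + α / 2 * (∑ i ∈ Finset.range j, k * b i ^ 2 + k * b j ^ 2)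
        ≤ (1 + k * B₂) * E + k * B₁ := by
      have h2 := mul_le_mul_of_nonneg_left hyoung hk
      have h3 := mul_le_mul_of_nonneg_left hPa hk
      linarith
    have hexp : 1 + k * B₂ ≤ Real.exp (k * B₂) := by
      have := Real.add_one_le_exp (k * B₂)
      linarith
    have hkB : 0 ≤ k * B₂ := by positivity
    have hsplit : Real.exp ((j + 1 : ℕ) * k * B₂) = Real.exp (k * B₂) * Real.exp (j * k * B₂) := by
      rw [← Real.exp_add]
      congr 1
      push_cast
      ring
    have hone : 1 ≤ Real.exp ((j + 1 : ℕ) * k * B₂) := Real.one_le_exp (by positivity)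
    calc _ ≤ (1 + k * B₂) * E + k * B₁ := hstep
      _ ≤ Real.exp (k * B₂) * ((C / 2 * a 0 + j * k * B₁) * Real.exp (j * k * B₂))
          + k * B₁ * Real.exp ((j + 1 : ℕ) * k * B₂) := by
          refine add_le_add (mul_le_mul hexp ih hE0 (Real.exp_pos _).le) ?_
          exact le_mul_of_one_le_right (by positivity) hone
      _ = _ := by
          rw [hsplit]
          push_cast
          ring

section AbsolutelyContinuous

theorem absolutelyContinuousOnInterval_of_dist_le {X Y : Type*} [PseudoMetricSpace X]
    [PseudoMetricSpace Y] {f : ℝ → X} {R : ℝ → Y} {a b L : ℝ} (hL : 0 ≤ L)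
    (hR : AbsolutelyContinuousOnInterval R a b)
    (h : ∀ x ∈ uIcc a b, ∀ y ∈ uIcc a b, dist (f x) (f y) ≤ L * dist (R x) (R y)) :
    AbsolutelyContinuousOnInterval f a b := by
  rw [absolutelyContinuousOnInterval_iff] at hR ⊢
  intro ε hε
  obtain ⟨δ, hδ, hR⟩ := hR (ε / (L + 1)) (by positivity)
  refine ⟨δ, hδ, fun E hE hEδ => ?_⟩
  have h1 := hR E hE hEδ
  have h2 : ∑ i ∈ Finset.range E.1, dist (f (E.2 i).1) (f (E.2 i).2)
      ≤ ∑ i ∈ Finset.range E.1, L * dist (R (E.2 i).1) (R (E.2 i).2) := by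
    refine Finset.sum_le_sum fun i hi => ?_
    have := hE.1 i hi
    exact h _ this.1 _ this.2
  rw [← Finset.mul_sum] at h2
  rw [lt_div_iff₀ (by positivity)] at h1
  have h3 : 0 ≤ ∑ i ∈ Finset.range E.1, dist (R (E.2 i).1) (R (E.2 i).2) :=
    Finset.sum_nonneg fun i _ => dist_nonneg
  linarith

theorem absolutelyContinuousOnInterval_norm_primitive {F : Type*} [NormedAddCommGroup F] {v : ℝ → F}
    {a b : ℝ} (hv : IntervalIntegrable v volume a b) :
    AbsolutelyContinuousOnInterval (fun t => ∫ s in a..t, ‖v s‖) a b :=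
  hv.norm.absolutelyContinuousOnInterval_intervalIntegral left_mem_uIcc

variable {F : Type*} [NormedAddCommGroup F] [NormedSpace ℝ F]

theorem dist_primitive_le {v : ℝ → F} {a b : ℝ} (hv : IntervalIntegrable v volume a b) :
    ∀ x ∈ uIcc a b, ∀ y ∈ uIcc a b, dist (∫ s in a..x, v s) (∫ s in a..y, v s)
      ≤ 1 * dist (∫ s in a..x, ‖v s‖) (∫ s in a..y, ‖v s‖) := by
  intro x hx y hy
  have h1 : ∀ z ∈ uIcc a b, IntervalIntegrable v volume a z := fun z hz =>
    hv.mono_set (uIcc_subset_uIcc_left hz)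
  rw [dist_eq_norm, dist_eq_norm, intervalIntegral.integral_interval_sub_left (h1 x hx) (h1 y hy),
    intervalIntegral.integral_interval_sub_left (h1 x hx).norm (h1 y hy).norm, one_mul,
    Real.norm_eq_abs]
  exact intervalIntegral.norm_integral_le_abs_integral_norm

theorem absolutelyContinuousOnInterval_primitive {v : ℝ → F} {a b : ℝ}
    (hv : IntervalIntegrable v volume a b) :
    AbsolutelyContinuousOnInterval (fun t => ∫ s in a..t, v s) a b :=
  absolutelyContinuousOnInterval_of_dist_le zero_le_one
    (absolutelyContinuousOnInterval_norm_primitive hv) (dist_primitive_le hv)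

/-- The fundamental theorem of calculus for absolutely continuous functions. -/
theorem integral_eq_sub_of_absolutelyContinuous [CompleteSpace F] {f f' : ℝ → F} {a b : ℝ}
    (hf : AbsolutelyContinuousOnInterval f a b)
    (hd : ∀ᵐ x, x ∈ uIcc a b → HasDerivAt f (f' x) x) (hi : IntervalIntegrable f' volume a b) :
    ∫ x in a..b, f' x = f b - f a := by
  have hg := hf.sub (absolutelyContinuousOnInterval_primitive hi)
  obtain ⟨C, hC⟩ := hg.const_of_ae_hasDerivAt_zero (by
    filter_upwards [hd, hi.ae_hasDerivAt_integral] with x h1 h2 hx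
    simpa using (h1 hx).sub (h2 hx a left_mem_uIcc))
  have h1 := hC a left_mem_uIcc
  have h2 := hC b right_mem_uIcc
  simp only [Pi.sub_apply, intervalIntegral.integral_same, sub_zero] at h1 h2
  rw [h1, ← h2]
  abel

theorem ae_hasDerivAt_primitive [CompleteSpace F] {v : ℝ → F} {a b : ℝ}
    (hv : IntervalIntegrable v volume a b) (c : F) :
    ∀ᵐ x, x ∈ uIcc a b → HasDerivAt (fun t => c + ∫ s in a..t, v s) (v x) x := by
  filter_upwards [hv.ae_hasDerivAt_integral] with x h hx
  exact (h hx a left_mem_uIcc).const_add c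

theorem absolutelyContinuousOnInterval_const_add_primitive {v : ℝ → F} {a b : ℝ}
    (hv : IntervalIntegrable v volume a b) (c : F) :
    AbsolutelyContinuousOnInterval (fun t => c + ∫ s in a..t, v s) a b :=
  absolutelyContinuousOnInterval_of_dist_le zero_le_one (absolutelyContinuousOnInterval_primitive hv)
    fun x _ y _ => by rw [dist_add_left, one_mul]

/-- Integration by parts against a smooth function vanishing at the end points. -/
theorem integral_deriv_smul_primitive [CompleteSpace F] {v : ℝ → F} {a b : ℝ}
    (hv : IntervalIntegrable v volume a b) (c : F) {φ : ℝ → ℝ} (hφ : ContDiff ℝ 1 φ)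
    (ha : φ a = 0) (hb : φ b = 0) :
    ∫ t in a..b, deriv φ t • (c + ∫ s in a..t, v s) = -∫ t in a..b, φ t • v t := by
  set M : ℝ → F := fun t => c + ∫ s in a..t, v s with hM
  have hMac := absolutelyContinuousOnInterval_const_add_primitive hv c
  have hd : ∀ᵐ x, x ∈ uIcc a b →
      HasDerivAt (fun t => φ t • M t) (φ x • v x + deriv φ x • M x) x := by
    filter_upwards [ae_hasDerivAt_primitive hv c] with x h hx
    exact ((hφ.differentiable (by simp)) x).hasDerivAt.smul (h hx)
  have i1 : IntervalIntegrable (fun t => φ t • v t) volume a b :=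
    hv.continuousOn_smul hφ.continuous.continuousOn
  have i2 : IntervalIntegrable (fun t => deriv φ t • M t) volume a b :=
    ((hφ.continuous_deriv le_rfl).continuousOn.smul hMac.continuousOn).intervalIntegrable
  have key := integral_eq_sub_of_absolutelyContinuous
    ((hφ.contDiffOn.absolutelyContinuousOnInterval).fun_smul hMac) hd (i1.add i2)
  rw [intervalIntegral.integral_add i1 i2, ha, hb, zero_smul, zero_smul, sub_zero] at key
  exact eq_neg_of_add_eq_zero_right key

/-- The chain rule for a quadratic form. -/
theorem integral_inner_primitive {H : Type*} [NormedAddCommGroup H] [InnerProductSpace ℝ H]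
    [CompleteSpace H] (A : H →L[ℝ] H) (hA : IsSelfAdjoint A) {v : ℝ → H} {a b : ℝ}
    (hv : IntervalIntegrable v volume a b) (c : H) :
    ∫ t in a..b, inner ℝ (A (c + ∫ s in a..t, v s)) (v t)
      = 1 / 2 * inner ℝ (A (c + ∫ s in a..b, v s)) (c + ∫ s in a..b, v s)
        - 1 / 2 * inner ℝ (A c) c := by
  set M : ℝ → H := fun t => c + ∫ s in a..t, v s with hM
  have hMac : AbsolutelyContinuousOnInterval M a b :=
    absolutelyContinuousOnInterval_const_add_primitive hv c
  have hsymm : ∀ x y : H, inner ℝ (A x) y = inner ℝ (A y) x := fun x y => by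
    rw [real_inner_comm]
    exact (ContinuousLinearMap.isSelfAdjoint_iff_isSymmetric.1 hA y x).symm
  obtain ⟨B, hB⟩ := hMac.exists_bound
  have hB0 : 0 ≤ B := (norm_nonneg _).trans (hB a left_mem_uIcc)
  have hac : AbsolutelyContinuousOnInterval (fun t => 1 / 2 * inner ℝ (A (M t)) (M t)) a b := by
    refine absolutelyContinuousOnInterval_of_dist_le (L := ‖A‖ * B) (by positivity) hMac ?_
    intro x hx y hy
    have e1 : ∀ p q : H, 1 / 2 * inner ℝ (A p) p - 1 / 2 * inner ℝ (A q) q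
        = 1 / 2 * inner ℝ (A (p - q)) (p + q) := fun p q => by
      rw [map_sub, inner_sub_left, inner_add_right, inner_add_right, hsymm q p]
      ring
    rw [dist_eq_norm, dist_eq_norm, e1 (M x) (M y), norm_mul]
    have h1 : ‖inner ℝ (A (M x - M y)) (M x + M y)‖ ≤ ‖A‖ * ‖M x - M y‖ * (B + B) :=
      (norm_inner_le_norm _ _).trans (mul_le_mul (A.le_opNorm _)
        ((norm_add_le _ _).trans (add_le_add (hB x hx) (hB y hy))) (norm_nonneg _) (by positivity))
    norm_num at h1 ⊢
    linarith
  have hd : ∀ᵐ x, x ∈ uIcc a b → HasDerivAt (fun t => 1 / 2 * inner ℝ (A (M t)) (M t))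
      (inner ℝ (A (M x)) (v x)) x := by
    filter_upwards [ae_hasDerivAt_primitive hv c] with x h hx
    have h1 : HasDerivAt M (v x) x := h hx
    have h2 : HasDerivAt (fun t => A (M t)) (A (v x)) x := A.hasFDerivAt.comp_hasDerivAt x h1
    have h3 := (h2.inner ℝ h1).const_mul (1 / 2 : ℝ)
    refine h3.congr_deriv ?_
    rw [hsymm (v x) (M x)]
    ring
  have hi : IntervalIntegrable (fun t => inner ℝ (A (M t)) (v t)) volume a b := by
    rw [intervalIntegrable_iff] at hv ⊢
    refine Integrable.mono' (g := fun t => ‖A‖ * B * ‖v t‖) (hv.norm.const_mul _) ?_ ?_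
    · refine AEStronglyMeasurable.inner ?_ hv.aestronglyMeasurable
      exact ((A.continuous.comp_continuousOn hMac.continuousOn).mono
        uIoc_subset_uIcc).aestronglyMeasurable measurableSet_uIoc
    · filter_upwards [ae_restrict_mem measurableSet_uIoc] with t ht
      refine (norm_inner_le_norm _ _).trans ?_
      gcongr
      exact (A.le_opNorm _).trans (by gcongr; exact hB t (uIoc_subset_uIcc ht))
  rw [integral_eq_sub_of_absolutelyContinuous hac hd hi]
  simp [hM]

end AbsolutelyContinuous

section WeakLimits

variable {H : Type*} [NormedAddCommGroup H] [InnerProductSpace ℝ H]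

theorem exists_tendsto_of_abs_le (U : Ultrafilter ℕ) {c : ℕ → ℝ} {B : ℝ} (hc : ∀ n, |c n| ≤ B) :
    ∃ l : ℝ, |l| ≤ B ∧ Tendsto c U (𝓝 l) := by
  have h1 : ↑(U.map c) ≤ 𝓟 (Icc (-B) B) := by
    rw [le_principal_iff]
    exact (Eventually.of_forall fun n => abs_le.1 (hc n) : ∀ᶠ n in (U : Filter ℕ), c n ∈ Icc (-B) B)
  obtain ⟨l, hl, hle⟩ := isCompact_Icc.ultrafilter_le_nhds (U.map c) h1
  exact ⟨l, abs_le.2 hl, hle⟩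

/-- Bounded sequences in a Hilbert space converge weakly along ultrafilters. -/
theorem exists_weak_limit [CompleteSpace H] (U : Ultrafilter ℕ) {x : ℕ → H} {B : ℝ}
    (hx : ∀ n, ‖x n‖ ≤ B) :
    ∃ y : H, ‖y‖ ≤ B ∧ ∀ z, Tendsto (fun n => inner ℝ (x n) z) U (𝓝 (inner ℝ y z)) := by
  have h : ∀ z : H, ∃ l : ℝ, |l| ≤ B * ‖z‖ ∧ Tendsto (fun n => inner ℝ (x n) z) U (𝓝 l) :=
    fun z => exists_tendsto_of_abs_le U fun n =>
      (abs_real_inner_le_norm _ _).trans (by gcongr; exact hx n)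
  choose l hlB hl using h
  let L : H →ₗ[ℝ] ℝ :=
    { toFun := l
      map_add' := fun a b => tendsto_nhds_unique (hl (a + b))
        (by simpa only [inner_add_right] using (hl a).add (hl b))
      map_smul' := fun c a => tendsto_nhds_unique (hl (c • a))
        (by simpa only [real_inner_smul_right, RingHom.id_apply, smul_eq_mul] using
          (hl a).const_mul c) }
  let L' : StrongDual ℝ H := L.mkContinuous B hlB
  refine ⟨(InnerProductSpace.toDual ℝ H).symm L', ?_, fun z => ?_⟩
  · rw [LinearIsometryEquiv.norm_map]
    exact L.mkContinuous_norm_le ((norm_nonneg _).trans (hx 0)) hlB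
  rw [InnerProductSpace.toDual_symm_apply]
  exact hl z

theorem tendsto_inner_of_weak_of_strong {ι : Type*} {l : Filter ι} {x : ι → H} {y : H} {B : ℝ}
    (hx : ∀ n, ‖x n‖ ≤ B) (hw : ∀ z, Tendsto (fun n => inner ℝ (x n) z) l (𝓝 (inner ℝ y z)))
    {z : ι → H} {z₀ : H} (hz : Tendsto z l (𝓝 z₀)) :
    Tendsto (fun n => inner ℝ (x n) (z n)) l (𝓝 (inner ℝ y z₀)) := by
  have h1 : Tendsto (fun n => inner ℝ (x n) (z n - z₀)) l (𝓝 0) := by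
    have h2 : Tendsto (fun n => B * ‖z n - z₀‖) l (𝓝 0) := by
      simpa using (tendsto_iff_norm_sub_tendsto_zero.1 hz).const_mul B
    refine squeeze_zero_norm (fun n => ?_) h2
    exact (norm_inner_le_norm _ _).trans (by gcongr; exact hx n)
  have h3 := h1.add (hw z₀)
  rw [zero_add] at h3
  refine h3.congr fun n => ?_
  rw [inner_sub_right]
  ring

end WeakLimits

section PiecewiseConstant

theorem stronglyMeasurable_pwConst {X : Type*} [TopologicalSpace X] (k : ℝ) (γ : ℕ → X) :
    StronglyMeasurable (pwConst k γ) :=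
  (StronglyMeasurable.of_discrete (f := γ)).comp_measurable
    (Nat.measurable_floor.comp (measurable_id.div_const k))

theorem floor_div_lt {k t : ℝ} (hk : 0 < k) {N : ℕ} (ht0 : 0 ≤ t) (ht : t < N * k) :
    ⌊t / k⌋₊ < N := by
  rw [Nat.floor_lt (by positivity), div_lt_iff₀ hk]
  exact ht

theorem pwConst_eq {X : Type*} {k t : ℝ} (hk : 0 < k) (γ : ℕ → X) {i : ℕ} (h1 : i * k ≤ t)
    (h2 : t < (i + 1 : ℕ) * k) : pwConst k γ t = γ i := by
  have : ⌊t / k⌋₊ = i := by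
    rw [Nat.floor_eq_iff]
    · rw [le_div_iff₀ hk, div_lt_iff₀ hk]
      exact ⟨h1, by exact_mod_cast h2⟩
    · have : 0 ≤ i * k := by positivity
      exact div_nonneg (this.trans h1) hk.le
  rw [pwConst, this]

variable {E : Type*} [NormedAddCommGroup E]

theorem memLp_pwConst {T k : ℝ} (hk : 0 < k) {N : ℕ} (hT : N * k = T) (γ : ℕ → E) (p : ℝ≥0∞) :
    MemLp (pwConst k γ) p (volume.restrict (Ioo 0 T)) := by
  have : IsFiniteMeasure (volume.restrict (Ioo 0 T)) := ⟨by simp⟩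
  refine MemLp.of_bound (stronglyMeasurable_pwConst k γ).aestronglyMeasurable
    (∑ i ∈ Finset.range N, ‖γ i‖) ?_
  filter_upwards [ae_restrict_mem measurableSet_Ioo] with t ht
  exact Finset.single_le_sum (f := fun i => ‖γ i‖) (fun i _ => norm_nonneg _)
    (Finset.mem_range.2 (floor_div_lt hk ht.1.le (hT ▸ ht.2)))

variable [NormedSpace ℝ E] [CompleteSpace E]

theorem integral_pwConst {k : ℝ} (hk : 0 < k) (γ : ℕ → E) (j : ℕ) :
    ∫ t in Ioo 0 (j * k), pwConst k γ t = ∑ i ∈ Finset.range j, k • γ i := by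
  have hmem : ∀ N : ℕ, IntervalIntegrable (pwConst k γ) volume 0 (N * k) := fun N => by
    rw [intervalIntegrable_iff_integrableOn_Ioo_of_le (by positivity)]
    exact (memLp_pwConst hk rfl γ 1).integrable le_rfl
  rw [← integral_Ioc_eq_integral_Ioo, ← intervalIntegral.integral_of_le (by positivity)]
  induction j with
  | zero => simp
  | succ j ih =>
    rw [Finset.sum_range_succ, ← ih, ← intervalIntegral.integral_add_adjacent_intervals (hmem j)
      ((hmem j).symm.trans (hmem (j + 1)))]
    congr 1
    have hle : (j : ℝ) * k ≤ (j + 1 : ℕ) * k := by push_cast; nlinarith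
    rw [intervalIntegral.integral_of_le hle, integral_Ioc_eq_integral_Ioo,
      setIntegral_congr_fun measurableSet_Ioo
        (fun t ht => pwConst_eq hk γ ht.1.le ht.2 : EqOn _ (fun _ => γ j) _), setIntegral_const]
    congr 1
    rw [Real.volume_real_Ioo_of_le hle]
    push_cast
    ring

end PiecewiseConstant

section TimeL2

/-- Restrictions of a fixed function to shrinking intervals tend to zero. -/
theorem tendsto_eLpNorm_indicator_Ico {E : Type*} [NormedAddCommGroup E] {T : ℝ} {g : ℝ → E}
    (hg : MemLp g 2 (volume.restrict (Ioo 0 T))) {l : Filter ℕ} {t : ℝ} {tn : ℕ → ℝ}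
    (ht : Tendsto tn l (𝓝 t)) :
    Tendsto (fun n => eLpNorm ((Ico (tn n) t).indicator g) 2 (volume.restrict (Ioo 0 T))) l
      (𝓝 0) := by
  rw [ENNReal.tendsto_nhds_zero]
  intro ε hε
  by_cases htop : ε = ⊤
  · simp [htop]
  obtain ⟨δ, hδ, h⟩ := hg.eLpNorm_indicator_le (by norm_num) (by norm_num)
    (ε := ε.toReal) (ENNReal.toReal_pos hε.ne' htop)
  have h1 : ∀ᶠ n in l, t - δ < tn n := ht.eventually (lt_mem_nhds (by linarith))
  filter_upwards [h1] with n hn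
  refine (h _ measurableSet_Ico ?_).trans (by rw [ENNReal.ofReal_toReal htop])
  refine (Measure.restrict_apply_le _ _).trans ?_
  rw [Real.volume_Ico]
  exact ENNReal.ofReal_le_ofReal (by linarith)

variable {H : Type*} [NormedAddCommGroup H] [InnerProductSpace ℝ H] {α : Type*}
  [MeasurableSpace α] {μ : Measure α}

theorem inner_toLp {a b : α → H} (ha : MemLp a 2 μ) (hb : MemLp b 2 μ) :
    inner ℝ (ha.toLp a) (hb.toLp b) = ∫ t, inner ℝ (a t) (b t) ∂μ := by
  rw [MeasureTheory.L2.inner_def]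
  refine integral_congr_ae ?_
  filter_upwards [ha.coeFn_toLp, hb.coeFn_toLp] with t h1 h2
  rw [h1, h2]

theorem norm_toLp_sq {a : α → H} (ha : MemLp a 2 μ) :
    ‖ha.toLp a‖ ^ 2 = ∫ t, ‖a t‖ ^ 2 ∂μ := by
  rw [← real_inner_self_eq_norm_sq, inner_toLp ha ha]
  simp only [real_inner_self_eq_norm_sq]

/-- Products of strongly and weakly convergent sequences, on time intervals with converging end
points. -/
theorem tendsto_setIntegral_inner {T : ℝ} {l : Filter ℕ} {g : ℝ → H} {gn V : ℕ → ℝ → H}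
    (hg : MemLp g 2 (volume.restrict (Ioo 0 T)))
    (hgn : ∀ n, MemLp (gn n) 2 (volume.restrict (Ioo 0 T)))
    (hlim : Tendsto (fun n => eLpNorm (fun s => gn n s - g s) 2 (volume.restrict (Ioo 0 T))) l
      (𝓝 0))
    (hV : ∀ n, MemLp (V n) 2 (volume.restrict (Ioo 0 T))) {B : ℝ}
    (hVB : ∀ n, ‖(hV n).toLp (V n)‖ ≤ B) {v : Lp H 2 (volume.restrict (Ioo 0 T))}
    (hw : ∀ z, Tendsto (fun n => inner ℝ ((hV n).toLp (V n)) z) l (𝓝 (inner ℝ v z)))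
    {t : ℝ} {tn : ℕ → ℝ} (htn : ∀ n, tn n ≤ t) (htT : t ≤ T) (ht : Tendsto tn l (𝓝 t)) :
    Tendsto (fun n => ∫ s in Ioo 0 (tn n), inner ℝ (gn n s) (V n s)) l
      (𝓝 (∫ s in Ioo 0 t, inner ℝ (g s) (v s))) := by
  have hind : ∀ {f w : ℝ → H} {r : ℝ} (_ : r ≤ T) (hf : MemLp f 2 (volume.restrict (Ioo 0 T)))
      (hw : MemLp w 2 (volume.restrict (Ioo 0 T))),
      inner ℝ (hw.toLp w) ((hf.indicator (measurableSet_Iio (a := r))).toLp _)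
        = ∫ s in Ioo 0 r, inner ℝ (f s) (w s) := by
    intro f w r hr hf hw
    rw [inner_toLp]
    have h1 : ∀ s, inner ℝ (w s) ((Iio r).indicator f s)
        = (Iio r).indicator (fun s => inner ℝ (f s) (w s)) s := by
      intro s
      by_cases hs : s ∈ Iio r
      · rw [indicator_of_mem hs, indicator_of_mem hs, real_inner_comm]
      · rw [indicator_of_notMem hs, indicator_of_notMem hs, inner_zero_right]
    simp only [h1]
    rw [integral_indicator measurableSet_Iio, Measure.restrict_restrict measurableSet_Iio]
    congr 2
    ext s
    simp only [mem_inter_iff, mem_Iio, mem_Ioo]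
    constructor
    · rintro ⟨h1, h2, _⟩
      exact ⟨h2, h1⟩
    · rintro ⟨h1, h2⟩
      exact ⟨h2, h1, h2.trans_le hr⟩
  have hz : Tendsto (fun n => ((hgn n).indicator (measurableSet_Iio (a := tn n))).toLp _) l
      (𝓝 ((hg.indicator (measurableSet_Iio (a := t))).toLp _)) := by
    rw [Lp.tendsto_Lp_iff_tendsto_eLpNorm'']
    have h0 := hlim.add (tendsto_eLpNorm_indicator_Ico hg ht)
    rw [add_zero] at h0
    refine tendsto_of_tendsto_of_tendsto_of_le_of_le tendsto_const_nhds h0 (fun n => zero_le)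
      fun n => ?_
    have e1 : (Iio (tn n)).indicator (gn n) - (Iio t).indicator g
        = (Iio (tn n)).indicator (fun s => gn n s - g s) - (Ico (tn n) t).indicator g := by
      ext s
      simp only [Pi.sub_apply, indicator, mem_Iio, mem_Ico]
      by_cases h1 : s < tn n
      · simp [h1, h1.trans_le (htn n), not_le.2 h1]
      · simp [h1, not_lt.1 h1]
    simp only
    rw [e1]
    refine (eLpNorm_sub_le ?_ ?_ (by norm_num)).trans (add_le_add (eLpNorm_indicator_le _) le_rfl)
    · exact ((hgn n).sub hg).aestronglyMeasurable.indicator measurableSet_Iio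
    · exact hg.aestronglyMeasurable.indicator measurableSet_Ico
  have key := tendsto_inner_of_weak_of_strong hVB hw hz
  have e2 : inner ℝ v ((hg.indicator (measurableSet_Iio (a := t))).toLp _)
      = ∫ s in Ioo 0 t, inner ℝ (g s) (v s) := by
    rw [← hind htT hg (Lp.memLp v), Lp.toLp_coeFn]
  rw [e2] at key
  exact key.congr fun n => hind ((htn n).trans htT) (hgn n) (hV n)

end TimeL2

section WeakGradient

variable {Ω : Set E3}

theorem integrable_smul_L2 {ψ : E3 → ℝ} (hψ : Continuous ψ) (hc : HasCompactSupport ψ) (u : L2 Ω) :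
    Integrable (fun x => ψ x • u x) (volume.restrict Ω) := by
  have h1 : MemLp ψ 2 (volume.restrict Ω) := hψ.memLp_of_hasCompactSupport hc
  rw [← memLp_one_iff_integrable]
  exact (Lp.memLp u).smul h1

/-- Integration against a test function is a continuous operation. -/
theorem exists_inner_eq_integral {ψ : E3 → ℝ} (hψ : Continuous ψ) (hc : HasCompactSupport ψ)
    (e : E3) : ∃ z : L2 Ω, ∀ u : L2 Ω, inner ℝ u z = inner ℝ (∫ x in Ω, ψ x • u x) e := by
  have h1 : MemLp (fun x => ψ x • e) 2 (volume.restrict Ω) :=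
    (hψ.smul continuous_const).memLp_of_hasCompactSupport hc.smul_right
  refine ⟨h1.toLp _, fun u => ?_⟩
  rw [real_inner_comm _ (∫ x in Ω, ψ x • u x), ← integral_inner (integrable_smul_L2 hψ hc u),
    MeasureTheory.L2.inner_def]
  refine integral_congr_ae ?_
  filter_upwards [h1.coeFn_toLp] with x hx
  rw [hx, real_inner_smul_right, real_inner_smul_right, real_inner_comm]

/-- Weak gradients are stable under weak convergence. -/
theorem hasWeakGradient_of_tendsto {ι : Type*} {l : Filter ι} [l.NeBot] {u : ι → L2 Ω}
    {G : ι → Fin 3 → L2 Ω} {u₀ : L2 Ω} {G₀ : Fin 3 → L2 Ω}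
    (h : ∀ n, HasWeakGradient Ω (u n) (G n))
    (hu : ∀ z, Tendsto (fun n => inner ℝ (u n) z) l (𝓝 (inner ℝ u₀ z)))
    (hG : ∀ j z, Tendsto (fun n => inner ℝ (G n j) z) l (𝓝 (inner ℝ (G₀ j) z))) :
    HasWeakGradient Ω u₀ G₀ := by
  intro φ hφ hc hs j
  refine ext_inner_right ℝ fun e => ?_
  obtain ⟨z₁, hz₁⟩ := exists_inner_eq_integral (Ω := Ω)
    ((hφ.continuous_fderiv (by simp)).clm_apply continuous_const)
    (hc.fderiv_apply ℝ (basisVec j)) e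
  obtain ⟨z₂, hz₂⟩ := exists_inner_eq_integral (Ω := Ω) hφ.continuous hc e
  rw [inner_neg_left, ← hz₁, ← hz₂]
  refine tendsto_nhds_unique (hu z₁) (((hG j z₂).neg).congr fun n => ?_)
  rw [hz₁, hz₂, h n φ hφ hc hs j, inner_neg_left]

theorem hasWeakGradient_unique (hΩ : IsOpen Ω) {u : L2 Ω} {G G' : Fin 3 → L2 Ω}
    (h : HasWeakGradient Ω u G) (h' : HasWeakGradient Ω u G') : G = G' := by
  funext j
  rw [← sub_eq_zero]
  have hae : ∀ᵐ x ∂volume, x ∈ Ω → (G j - G' j) x = 0 := by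
    refine hΩ.ae_eq_zero_of_integral_contDiff_smul_eq_zero ?_ fun φ hφ hc hs => ?_
    · have : LocallyIntegrable (G j - G' j) (volume.restrict Ω) :=
        (Lp.memLp (G j - G' j)).locallyIntegrable (by norm_num)
      exact locallyIntegrableOn_of_locallyIntegrable_restrict this
    · have h1 := h φ hφ hc hs j
      rw [h' φ hφ hc hs j, neg_inj] at h1
      rw [← setIntegral_eq_integral_of_forall_compl_eq_zero (s := Ω)]
      · have h2 : ∫ x in Ω, φ x • (G j - G' j) x
            = ∫ x in Ω, (φ x • G j x - φ x • G' j x) := by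
          refine integral_congr_ae ?_
          filter_upwards [Lp.coeFn_sub (G j) (G' j)] with x hx
          rw [hx, Pi.sub_apply, smul_sub]
        rw [h2, integral_sub (integrable_smul_L2 hφ.continuous hc _)
          (integrable_smul_L2 hφ.continuous hc _), h1, sub_self]
      · intro x hx
        rw [image_eq_zero_of_notMem_tsupport fun h => hx (hs h), zero_smul]
  refine Lp.ext ?_
  filter_upwards [(ae_restrict_iff' hΩ.measurableSet).2 hae, Lp.coeFn_zero E3 2 (volume.restrict Ω)]
    with x h1 h2
  rw [h1, h2]
  rfl

/-- The weak gradient of a measurable family depends measurably on the parameter. -/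
theorem exists_measurable_weakGradient (hΩ : IsOpen Ω) {α : Type*} [MeasurableSpace α]
    {μ : Measure α} {m : α → L2 Ω} (hm : AEStronglyMeasurable m μ)
    (h : ∀ᵐ t ∂μ, ∃ G, HasWeakGradient Ω (m t) G) :
    ∃ G : α → Fin 3 → L2 Ω, (∀ j, AEStronglyMeasurable (fun t => G t j) μ) ∧
      ∀ᵐ t ∂μ, HasWeakGradient Ω (m t) (G t) := by
  have : Fact ((2 : ℝ≥0∞) ≠ ⊤) := ⟨by norm_num⟩
  let _ : MeasurableSpace (L2 Ω) := borel _
  have : BorelSpace (L2 Ω) := ⟨rfl⟩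
  have : SecondCountableTopology (L2 Ω) := Lp.SecondCountableTopology
  have : PolishSpace (L2 Ω) := inferInstance
  have : PolishSpace (L2 Ω × (Fin 3 → L2 Ω)) := inferInstance
  let W : Set (L2 Ω × (Fin 3 → L2 Ω)) := {p | HasWeakGradient Ω p.1 p.2}
  have hW : IsClosed W := by
    rw [← isSeqClosed_iff_isClosed]
    intro p q hp hpq
    have h1 := (continuous_fst.tendsto q).comp hpq
    have h2 : ∀ j, Tendsto (fun n => (p n).2 j) atTop (𝓝 (q.2 j)) := fun j =>
      (((continuous_apply j).comp continuous_snd).tendsto q).comp hpq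
    exact hasWeakGradient_of_tendsto hp (fun z => h1.inner tendsto_const_nhds)
      fun j z => (h2 j).inner tendsto_const_nhds
  have : PolishSpace W := hW.polishSpace
  have hfc : Continuous fun p : W => p.1.1 := continuous_fst.comp continuous_subtype_val
  have hfi : Function.Injective fun p : W => p.1.1 := by
    rintro ⟨⟨u, G⟩, hp⟩ ⟨⟨u', G'⟩, hp'⟩ (rfl : u = u')
    have : G = G' := hasWeakGradient_unique hΩ hp hp'
    subst this
    rfl
  obtain ⟨D, hD, hDW⟩ := (hfc.measurableEmbedding hfi).exists_measurable_extend
    (g := fun p : W => p.1.2) (continuous_snd.comp continuous_subtype_val).measurable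
    fun _ => ⟨fun _ => 0⟩
  refine ⟨fun t => D (m t), fun j => ?_, ?_⟩
  · exact (((measurable_pi_apply j).comp hD).comp_aemeasurable hm.aemeasurable).aestronglyMeasurable
  · filter_upwards [h] with t ⟨G, hG⟩
    have : D (m t) = G := congrFun hDW ⟨(m t, G), hG⟩
    rw [this]
    exact hG

/-- Elements of `L²` are determined by their inner products with simple functions. -/
theorem L2_ext_of_inner_indicator {w w' : L2 Ω} (hfin : volume Ω ≠ ⊤)
    (h : ∀ (A : Set E3) (hA : MeasurableSet A) (hA' : volume.restrict Ω A ≠ ⊤) (e : E3),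
      inner ℝ (indicatorConstLp 2 hA hA' e) w = inner ℝ (indicatorConstLp 2 hA hA' e) w') :
    w = w' := by
  have : IsFiniteMeasure (volume.restrict Ω) := ⟨by simpa using hfin.lt_top⟩
  rw [← sub_eq_zero, Lp.eq_zero_iff_ae_eq_zero]
  refine Lp.ae_eq_zero_of_forall_setIntegral_eq_zero _ (by norm_num) (by norm_num)
    (fun s _ _ => ((Lp.memLp _).integrable (by norm_num)).integrableOn) fun s hs hs' => ?_
  refine ext_inner_left ℝ fun e => ?_
  rw [← MeasureTheory.L2.inner_indicatorConstLp_eq_inner_setIntegral ℝ hs hs'.ne, inner_sub_right,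
    h s hs hs'.ne e, sub_self, inner_zero_right]

end WeakGradient

section SchemeBounds

variable {Ω : Set E3} {K : Geometry.SimplicialComplex ℝ E3} {Cexch α θ k T : ℝ} {N : ℕ}
  {pih : L2 Ω → L2 Ω} {fh : L2 Ω} {m v : ℕ → E3 → E3}

/-- The a priori bounds for the scheme. -/
theorem IsSchemeOutput.bounds (hK : IsTriangulation K Ω) (hΩ : IsOpen Ω)
    (ha : AngleCondition Ω K) (hS : IsSchemeOutput Ω K Cexch α θ k N pih fh m v)
    (hC : 0 < Cexch) (hα : 0 < α) (hθ : 1 / 2 < θ) (hk : 0 < k) (hT : N * k = T) {F P A : ℝ}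
    (hF : ‖fh‖ ≤ F)
    (hP : ∀ (w : L2 Ω) (G : Fin 3 → L2 Ω), HasWeakGradient Ω w G →
      (∀ᵐ x ∂(volume.restrict Ω), ‖w x‖ ≤ 1) → ‖pih w‖ ≤ P * (1 + gradNorm G))
    (hA : gradInner (discreteGrad Ω (m 0)) (discreteGrad Ω (m 0)) ≤ A) {j : ℕ} (hj : j ≤ N) :
    Cexch / 2 * gradInner (discreteGrad Ω (m j)) (discreteGrad Ω (m j))
        + α / 2 * ∑ i ∈ Finset.range j, k * ‖toL2 Ω (v i)‖ ^ 2
      ≤ (Cexch / 2 * A + T * ((F + P) ^ 2 / α)) * Real.exp (T * (2 * P ^ 2 / (α * Cexch))) := by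
  have hjT : j * k ≤ T := by
    rw [← hT]
    gcongr
  have key := gronwall_dissipation (C := Cexch) (α := α) (k := k) (F := F) (P := P) (N := N)
    (a := fun i => gradInner (discreteGrad Ω (m i)) (discreteGrad Ω (m i)))
    (b := fun i => ‖toL2 Ω (v i)‖) hC hα hk.le (fun i => gradInner_self_nonneg _) ?_ hj
  · refine key.trans ?_
    have h0 := gradInner_self_nonneg (discreteGrad Ω (m 0))
    have h1 : 0 ≤ j * k := by positivity
    have h2 : 0 ≤ A := h0.trans hA
    have h3 : 0 ≤ T := h1.trans hjT
    gcongr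
  · intro i hi
    refine (hS.energy_step hK hΩ ha hC hθ hi).trans ?_
    have hmi := hS.mem_discreteMag hi.le
    have h1 := hP _ _ (hasWeakGradient_P1 hK hΩ hmi.1) (by
      filter_upwards [coeFn_toL2_P1 hK hΩ hmi.1, ae_restrict_mem hΩ.measurableSet] with x h1 h2
      rw [h1]
      exact discreteMag_norm_le hK hmi (subset_space hK h2))
    rw [gradNorm_eq_sqrt] at h1
    gcongr
    refine (real_inner_le_norm _ _).trans ?_
    gcongr
    exact (norm_sub_le _ _).trans (add_le_add hF h1)

theorem abs_inner_indicator_le {A : Set E3} (hA : MeasurableSet A)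
    (hA' : volume.restrict Ω A ≠ ⊤) (hfin : volume Ω ≠ ⊤) (e : E3) (w : L2 Ω) :
    |inner ℝ (indicatorConstLp 2 hA hA' e) w| ≤ ‖e‖ * ∫ x in Ω, ‖w x‖ := by
  have : IsFiniteMeasure (volume.restrict Ω) := ⟨by simpa using hfin.lt_top⟩
  have hi : Integrable w (volume.restrict Ω) := (Lp.memLp w).integrable (by norm_num)
  rw [MeasureTheory.L2.inner_indicatorConstLp_eq_inner_setIntegral ℝ hA hA']
  refine (abs_real_inner_le_norm _ _).trans ?_
  gcongr
  exact (norm_integral_le_integral_norm _).trans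
    (setIntegral_le_integral hi.norm (Eventually.of_forall fun x => norm_nonneg _))

/-- The discrete magnetization as an approximate primitive of the discrete velocity. -/
theorem IsSchemeOutput.abs_inner_sub_le (hK : IsTriangulation K Ω) (hΩ : IsOpen Ω)
    (hS : IsSchemeOutput Ω K Cexch α θ k N pih fh m v) (hk : 0 < k)
    {B : ℝ} (hB : ∑ i ∈ Finset.range N, k * ‖toL2 Ω (v i)‖ ^ 2 ≤ B)
    {A : Set E3} (hA : MeasurableSet A) (hA' : volume.restrict Ω A ≠ ⊤) (hfin : volume Ω ≠ ⊤)
    (e : E3) {j : ℕ} (hj : j ≤ N) :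
    |inner ℝ (indicatorConstLp 2 hA hA' e) (toL2 Ω (m j))
        - (inner ℝ (indicatorConstLp 2 hA hA' e) (toL2 Ω (m 0))
        + ∫ s in Ioo 0 (j * k), inner ℝ (indicatorConstLp 2 hA hA' e)
          (pwConst k (fun i => toL2 Ω (v i)) s))| ≤ 33 * ‖e‖ * B * k := by
  set z := indicatorConstLp 2 hA hA' e with hz
  have h1 : ∫ s in Ioo 0 (j * k), inner ℝ z (pwConst k (fun i => toL2 Ω (v i)) s)
      = ∑ i ∈ Finset.range j, k * inner ℝ z (toL2 Ω (v i)) :=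
    integral_pwConst hk (fun i => inner ℝ z (toL2 Ω (v i))) j
  have h2 : inner ℝ z (toL2 Ω (m j)) - inner ℝ z (toL2 Ω (m 0))
      = ∑ i ∈ Finset.range j, (inner ℝ z (toL2 Ω (m (i + 1))) - inner ℝ z (toL2 Ω (m i))) :=
    (Finset.sum_range_sub (fun i => inner ℝ z (toL2 Ω (m i))) j).symm
  rw [h1, ← sub_sub, h2, ← Finset.sum_sub_distrib]
  have h3 : ∀ i ∈ Finset.range j,
      |inner ℝ z (toL2 Ω (m (i + 1))) - inner ℝ z (toL2 Ω (m i)) - k * inner ℝ z (toL2 Ω (v i))|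
        ≤ 33 * ‖e‖ * k * (k * ‖toL2 Ω (v i)‖ ^ 2) := by
    intro i hi
    have hi' : i < N := (Finset.mem_range.1 hi).trans_le hj
    rw [← real_inner_smul_right, ← inner_sub_right, ← inner_sub_right]
    refine (abs_inner_indicator_le hA hA' hfin e _).trans ?_
    have := mul_le_mul_of_nonneg_left (hS.integral_increment_le hK hΩ hi') (norm_nonneg e)
    exact this.trans (le_of_eq (by ring))
  refine (Finset.abs_sum_le_sum_abs _ _).trans ((Finset.sum_le_sum h3).trans ?_)
  rw [← Finset.mul_sum]
  have h4 : ∑ i ∈ Finset.range j, k * ‖toL2 Ω (v i)‖ ^ 2 ≤ B :=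
    (Finset.sum_le_sum_of_subset_of_nonneg (Finset.range_mono hj)
      fun i _ _ => by positivity).trans hB
  calc _ ≤ 33 * ‖e‖ * k * B := by gcongr
    _ = _ := by ring

/-- The discrete energy inequality, tested with an arbitrary gradient `G` and velocity `u`. -/
theorem IsSchemeOutput.energy_integral (hK : IsTriangulation K Ω) (hΩ : IsOpen Ω)
    (ha : AngleCondition Ω K) (hS : IsSchemeOutput Ω K Cexch α θ k N pih fh m v)
    (hC : 0 < Cexch) (hα : 0 < α) (hθ : 1 / 2 < θ) (hk : 0 < k) {j : ℕ}
    (hj : j ≤ N) {t : ℝ} (hjt : j * k ≤ t) (htT : t ≤ T) (G : Fin 3 → L2 Ω) {u : ℝ → L2 Ω}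
    (hu : MemLp u 2 (volume.restrict (Ioo 0 T))) :
    Cexch / 2 * (2 * gradInner (discreteGrad Ω (m j)) G - gradInner G G)
        + α * (2 * (∫ s in Ioo 0 (j * k), inner ℝ (u s) (pwConst k (fun i => toL2 Ω (v i)) s))
          - ∫ s in Ioo 0 t, ‖u s‖ ^ 2)
      ≤ Cexch / 2 * gradInner (discreteGrad Ω (m 0)) (discreteGrad Ω (m 0))
        + ∫ s in Ioo 0 (j * k), inner ℝ (pwConst k (fun i => fh - pih (toL2 Ω (m i))) s)
            (pwConst k (fun i => toL2 Ω (v i)) s) := by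
  set V := pwConst k (fun i => toL2 Ω (v i)) with hV
  have h1 := hS.energy_sum hK hΩ ha hC hθ hj
  have h2 : ∫ s in Ioo 0 (j * k), inner ℝ (pwConst k (fun i => fh - pih (toL2 Ω (m i))) s) (V s)
      = ∑ i ∈ Finset.range j, k * inner ℝ (fh - pih (toL2 Ω (m i))) (toL2 Ω (v i)) :=
    integral_pwConst hk (fun i => inner ℝ (fh - pih (toL2 Ω (m i))) (toL2 Ω (v i))) j
  have h3 : ∫ s in Ioo 0 (j * k), ‖V s‖ ^ 2 = ∑ i ∈ Finset.range j, k * ‖toL2 Ω (v i)‖ ^ 2 :=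
    integral_pwConst hk (fun i => ‖toL2 Ω (v i)‖ ^ 2) j
  have h4 : ∑ i ∈ Finset.range j, k * (α * ‖toL2 Ω (v i)‖ ^ 2)
      = α * ∫ s in Ioo 0 (j * k), ‖V s‖ ^ 2 := by
    rw [h3, Finset.mul_sum]
    exact Finset.sum_congr rfl fun i _ => by ring
  rw [h4, ← h2] at h1
  have h5 : 2 * gradInner (discreteGrad Ω (m j)) G - gradInner G G
      ≤ gradInner (discreteGrad Ω (m j)) (discreteGrad Ω (m j)) := by
    have h := gradInner_add_smul_self (discreteGrad Ω (m j)) G (-1)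
    have h' := gradInner_self_nonneg (discreteGrad Ω (m j) + (-1 : ℝ) • G)
    linarith
  have hsub : Ioo 0 (j * k) ⊆ Ioo 0 t := Ioo_subset_Ioo_right hjt
  have hsub' : Ioo 0 t ⊆ Ioo 0 T := Ioo_subset_Ioo_right htT
  have hVm : MemLp V 2 (volume.restrict (Ioo 0 (j * k))) := memLp_pwConst hk rfl _ 2
  have hut : MemLp u 2 (volume.restrict (Ioo 0 t)) :=
    hu.mono_measure (Measure.restrict_mono_set _ hsub')
  have huj : MemLp u 2 (volume.restrict (Ioo 0 (j * k))) :=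
    hut.mono_measure (Measure.restrict_mono_set _ hsub)
  have i1 : Integrable (fun s => ‖u s‖ ^ 2) (volume.restrict (Ioo 0 (j * k))) :=
    huj.integrable_norm_pow (by norm_num)
  have i2 : Integrable (fun s => ‖V s‖ ^ 2) (volume.restrict (Ioo 0 (j * k))) :=
    hVm.integrable_norm_pow (by norm_num)
  have i3 : Integrable (fun s => inner ℝ (u s) (V s)) (volume.restrict (Ioo 0 (j * k))) := by
    refine Integrable.mono' (i1.add i2)
      (huj.aestronglyMeasurable.inner hVm.aestronglyMeasurable) (Eventually.of_forall fun s => ?_)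
    refine (norm_inner_le_norm _ _).trans ?_
    simp only [Pi.add_apply]
    nlinarith [sq_nonneg (‖u s‖ - ‖V s‖), sq_nonneg ‖u s‖, sq_nonneg ‖V s‖]
  have h6 : 2 * (∫ s in Ioo 0 (j * k), inner ℝ (u s) (V s)) - ∫ s in Ioo 0 t, ‖u s‖ ^ 2
      ≤ ∫ s in Ioo 0 (j * k), ‖V s‖ ^ 2 := by
    have h7 : ∫ s in Ioo 0 (j * k), 2 * inner ℝ (u s) (V s)
        ≤ ∫ s in Ioo 0 (j * k), (‖u s‖ ^ 2 + ‖V s‖ ^ 2) :=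
      integral_mono (i3.const_mul 2) (i1.add i2) fun s => by
        have := norm_sub_sq_real (u s) (V s)
        have h' := sq_nonneg ‖u s - V s‖
        simp only
        linarith
    rw [integral_const_mul, integral_add i1 i2] at h7
    have h8 : ∫ s in Ioo 0 (j * k), ‖u s‖ ^ 2 ≤ ∫ s in Ioo 0 t, ‖u s‖ ^ 2 :=
      setIntegral_mono_set (hut.integrable_norm_pow (by norm_num))
        (Eventually.of_forall fun s => by positivity) hsub.eventuallyLE
    linarith
  have h9 := mul_le_mul_of_nonneg_left h5 (by positivity : 0 ≤ Cexch / 2)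
  have h10 := mul_le_mul_of_nonneg_left h6 hα.le
  linarith

end SchemeBounds

theorem tendsto_floor_mul {k : ℕ → ℝ} (hk : ∀ n, 0 < k n) (hk0 : Tendsto k atTop (𝓝 0)) {t : ℝ}
    (ht : 0 ≤ t) : Tendsto (fun n => (⌊t / k n⌋₊ : ℝ) * k n) atTop (𝓝 t) := by
  have h1 : Tendsto (fun n => t - k n) atTop (𝓝 t) := by simpa using hk0.const_sub t
  refine tendsto_of_tendsto_of_tendsto_of_le_of_le h1 tendsto_const_nhds (fun n => ?_) fun n => ?_
  · have := Nat.lt_floor_add_one (t / k n)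
    rw [div_lt_iff₀ (hk n)] at this
    simp only
    linarith
  · have := Nat.floor_le (div_nonneg ht (hk n).le)
    rwa [le_div_iff₀ (hk n)] at this

theorem setIntegral_Ioo_eq {E : Type*} [NormedAddCommGroup E] [NormedSpace ℝ E] (w : ℝ → E) {t : ℝ}
    (ht : 0 ≤ t) : ∫ s in Ioo 0 t, w s = ∫ s in (0)..t, w s := by
  rw [intervalIntegral.integral_of_le ht, integral_Ioc_eq_integral_Ioo]

theorem tendsto_eLpNorm_const_sub {E α : Type*} [NormedAddCommGroup E] [MeasurableSpace α]
    {μ : Measure α} [IsFiniteMeasure μ] {c : ℕ → E} {c₀ : E} (hc : Tendsto c atTop (𝓝 c₀))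
    {w : ℕ → α → E} {w₀ : α → E} (hw : ∀ n, AEStronglyMeasurable (w n) μ)
    (hw₀ : AEStronglyMeasurable w₀ μ)
    (h : Tendsto (fun n => eLpNorm (fun s => w n s - w₀ s) 2 μ) atTop (𝓝 0)) :
    Tendsto (fun n => eLpNorm (fun s => c n - w n s - (c₀ - w₀ s)) 2 μ) atTop (𝓝 0) := by
  have h1 : Tendsto (fun n => eLpNorm (fun _ : α => c n - c₀) 2 μ) atTop (𝓝 0) := by
    have h2 : Tendsto (fun n => ‖c n - c₀‖ₑ) atTop (𝓝 0) := by
      simpa using (hc.sub_const c₀).enorm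
    have h3 : ∀ n, eLpNorm (fun _ : α => c n - c₀) 2 μ
        = ‖c n - c₀‖ₑ * μ univ ^ (1 / (2 : ℝ≥0∞).toReal) := fun n =>
      eLpNorm_const' _ (by norm_num) (by norm_num)
    simp only [h3]
    have h4 : μ univ ^ (1 / (2 : ℝ≥0∞).toReal) ≠ ⊤ :=
      ENNReal.rpow_ne_top_of_nonneg (by positivity) (measure_ne_top _ _)
    simpa using ENNReal.Tendsto.mul_const h2 (Or.inr h4)
  have h0 := h1.add h
  rw [add_zero] at h0
  refine tendsto_of_tendsto_of_tendsto_of_le_of_le tendsto_const_nhds h0 (fun n => zero_le)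
    fun n => ?_
  have e1 : (fun s => c n - w n s - (c₀ - w₀ s)) = (fun _ => c n - c₀) - fun s => w n s - w₀ s := by
    funext s
    simp only [Pi.sub_apply]
    abel
  simp only
  rw [e1]
  exact eLpNorm_sub_le aestronglyMeasurable_const ((hw n).sub hw₀) (by norm_num)

/-- The work of the lower order terms along a trajectory with velocity `v`. -/
theorem setIntegral_inner_affine {H : Type*} [NormedAddCommGroup H] [InnerProductSpace ℝ H]
    [CompleteSpace H] (A : H →L[ℝ] H) (hA : IsSelfAdjoint A) (f c : H) {T : ℝ} {m v : ℝ → H}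
    (hm : MemLp m 2 (volume.restrict (Ioo 0 T))) (hv : MemLp v 2 (volume.restrict (Ioo 0 T)))
    (hmv : ∀ᵐ s ∂(volume.restrict (Ioo 0 T)), m s = c + ∫ r in (0)..s, v r) {t : ℝ}
    (ht : t ∈ Ioo 0 T) (hmt : m t = c + ∫ r in (0)..t, v r) :
    ∫ s in Ioo 0 t, inner ℝ (f - A (m s)) (v s)
      = (inner ℝ f (m t) - inner ℝ f c)
        - (1 / 2 * inner ℝ (A (m t)) (m t) - 1 / 2 * inner ℝ (A c) c) := by
  have hTfin : IsFiniteMeasure (volume.restrict (Ioo 0 T)) := ⟨by simp⟩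
  have hsub : Ioo 0 t ⊆ Ioo 0 T := Ioo_subset_Ioo_right ht.2.le
  have hvt : IntegrableOn v (Ioo 0 t) := IntegrableOn.mono_set (hv.integrable (by norm_num)) hsub
  have hvi : IntervalIntegrable v volume 0 t :=
    (intervalIntegrable_iff_integrableOn_Ioo_of_le ht.1.le).2 hvt
  have i0 : ∀ {w : ℝ → H}, MemLp w 2 (volume.restrict (Ioo 0 T)) →
      IntegrableOn (fun s => inner ℝ (w s) (v s)) (Ioo 0 t) := fun {w} hw => by
    have h1 : Integrable (fun s => inner ℝ (hw.toLp w s) (hv.toLp v s)) (volume.restrict (Ioo 0 T)) :=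
      MeasureTheory.L2.integrable_inner _ _
    have h2 : Integrable (fun s => inner ℝ (w s) (v s)) (volume.restrict (Ioo 0 T)) :=
      h1.congr (by filter_upwards [hw.coeFn_toLp, hv.coeFn_toLp] with s hs hs'; rw [hs, hs'])
    exact IntegrableOn.mono_set h2 hsub
  have e1 : ∫ s in Ioo 0 t, inner ℝ (A (m s)) (v s)
      = ∫ s in (0)..t, inner ℝ (A (c + ∫ r in (0)..s, v r)) (v s) := by
    rw [← setIntegral_Ioo_eq (fun s => inner ℝ (A (c + ∫ r in (0)..s, v r)) (v s)) ht.1.le]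
    refine integral_congr_ae ?_
    filter_upwards [ae_restrict_of_ae_restrict_of_subset hsub hmv] with s hs
    rw [hs]
  simp only [inner_sub_left]
  have hAm : MemLp (fun s => A (m s)) 2 (volume.restrict (Ioo 0 T)) := A.comp_memLp' hm
  rw [integral_sub (i0 (memLp_const f)) (i0 hAm), integral_inner hvt, e1,
    integral_inner_primitive A hA hvi c, setIntegral_Ioo_eq v ht.1.le, ← hmt]
  rw [hmt, inner_add_right f c]
  ring

/-- Bounds which are uniform along a sequence of discretizations. -/
theorem exists_uniform_bound {Ω : Set E3} (hΩ : IsOpen Ω) {T Cexch α θ : ℝ} (hT : 0 < T)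
    (hC : 0 < Cexch) (hα : 0 < α) (hθ : 1 / 2 < θ) {f : L2 Ω} {G₀ : Fin 3 → L2 Ω}
    {N : ℕ → ℕ} (hN : ∀ n, 0 < N n)
    {K : ℕ → Geometry.SimplicialComplex ℝ E3} (hK : ∀ n, IsTriangulation (K n) Ω)
    (hKa : ∀ n, AngleCondition Ω (K n)) {pih : ℕ → L2 Ω → L2 Ω}
    (hpih : ∃ C : ℝ, ∀ n, ∀ (w : L2 Ω) (G : Fin 3 → L2 Ω), HasWeakGradient Ω w G →
      (∀ᵐ x ∂(volume.restrict Ω), ‖w x‖ ≤ 1) → ‖pih n w‖ ≤ C * (1 + gradNorm G))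
    {fh : ℕ → L2 Ω} (hfh : Tendsto fh atTop (𝓝 f)) {mh vh : ℕ → ℕ → E3 → E3}
    (hmh : ∀ n, IsSchemeOutput Ω (K n) Cexch α θ (T / N n) (N n) (pih n) (fh n) (mh n) (vh n))
    (hGh0 : ∀ j, Tendsto (fun n => discreteGrad Ω (mh n 0) j) atTop (𝓝 (G₀ j))) :
    ∃ B : ℝ, 0 ≤ B ∧ ∀ n,
      (∀ j ≤ N n, gradInner (discreteGrad Ω (mh n j)) (discreteGrad Ω (mh n j)) ≤ B) ∧
      ∑ i ∈ Finset.range (N n), T / N n * ‖toL2 Ω (vh n i)‖ ^ 2 ≤ B := by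
  obtain ⟨P, hP⟩ := hpih
  obtain ⟨F, hF⟩ := hfh.norm.bddAbove_range
  have hA : Tendsto (fun n => gradInner (discreteGrad Ω (mh n 0)) (discreteGrad Ω (mh n 0))) atTop
      (𝓝 (gradInner G₀ G₀)) := tendsto_finsetSum _ fun j _ => (hGh0 j).inner (hGh0 j)
  obtain ⟨A, hA⟩ := hA.bddAbove_range
  set R := (Cexch / 2 * A + T * ((F + P) ^ 2 / α)) * Real.exp (T * (2 * P ^ 2 / (α * Cexch)))
  have hk : ∀ n, 0 < T / N n := fun n => div_pos hT (by exact_mod_cast hN n)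
  have hkT : ∀ n, N n * (T / N n) = T := fun n => by
    have : (N n : ℝ) ≠ 0 := by exact_mod_cast (hN n).ne'
    field_simp
  have key : ∀ n, ∀ j ≤ N n,
      Cexch / 2 * gradInner (discreteGrad Ω (mh n j)) (discreteGrad Ω (mh n j))
        + α / 2 * ∑ i ∈ Finset.range j, T / N n * ‖toL2 Ω (vh n i)‖ ^ 2 ≤ R := fun n j hj =>
    (hmh n).bounds (hK n) hΩ (hKa n) hC hα hθ (hk n) (hkT n) (hF ⟨n, rfl⟩) (hP n) (hA ⟨n, rfl⟩) hj
  have hs : ∀ n j, 0 ≤ ∑ i ∈ Finset.range j, T / N n * ‖toL2 Ω (vh n i)‖ ^ 2 := fun n j =>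
    Finset.sum_nonneg fun i _ => mul_nonneg (hk n).le (sq_nonneg _)
  have hg : ∀ n j, 0 ≤ gradInner (discreteGrad Ω (mh n j)) (discreteGrad Ω (mh n j)) :=
    fun n j => gradInner_self_nonneg _
  have hR : 0 ≤ R := (add_nonneg (mul_nonneg (by positivity) (hg 0 0))
    (mul_nonneg (by positivity) (hs 0 0))).trans (key 0 0 (Nat.zero_le _))
  refine ⟨2 / Cexch * R + 2 / α * R, by positivity, fun n => ⟨fun j hj => ?_, ?_⟩⟩
  · have h1 : gradInner (discreteGrad Ω (mh n j)) (discreteGrad Ω (mh n j)) ≤ 2 / Cexch * R := by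
      have h2 := key n j hj
      have h3 := mul_nonneg (half_pos hα).le (hs n j)
      rw [div_mul_eq_mul_div, le_div_iff₀ hC]
      linarith
    have : 0 ≤ 2 / α * R := by positivity
    linarith
  · have h1 : ∑ i ∈ Finset.range (N n), T / N n * ‖toL2 Ω (vh n i)‖ ^ 2 ≤ 2 / α * R := by
      have h2 := key n (N n) le_rfl
      have h3 := mul_nonneg (half_pos hC).le (hg n (N n))
      rw [div_mul_eq_mul_div, le_div_iff₀ hα]
      linarith
    have : 0 ≤ 2 / Cexch * R := by positivity
    linarith

/-- The velocity and the gradient of the limit of a sequence of discrete solutions which converges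
almost everywhere in time, with the energy inequality in integrated form. -/
theorem exists_velocity_and_gradient
    {Ω : Set E3} (hΩ : IsOpen Ω) {T Cexch α θ : ℝ} (hT : 0 < T) (hC : 0 < Cexch) (hα : 0 < α)
    (hθ : 1 / 2 < θ) (pi : L2 Ω →L[ℝ] L2 Ω)
    (f m₀ : L2 Ω) (G₀ : Fin 3 → L2 Ω)
    (N : ℕ → ℕ) (hN : ∀ n, 0 < N n) (hN0 : Tendsto N atTop atTop)
    (K : ℕ → Geometry.SimplicialComplex ℝ E3) (hK : ∀ n, IsTriangulation (K n) Ω)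
    (hKa : ∀ n, AngleCondition Ω (K n)) (pih : ℕ → L2 Ω → L2 Ω)
    (hpih : ∃ C : ℝ, ∀ n, ∀ (w : L2 Ω) (G : Fin 3 → L2 Ω), HasWeakGradient Ω w G →
      (∀ᵐ x ∂(volume.restrict Ω), ‖w x‖ ≤ 1) → ‖pih n w‖ ≤ C * (1 + gradNorm G))
    (fh : ℕ → L2 Ω) (hfh : Tendsto fh atTop (𝓝 f)) (mh vh : ℕ → ℕ → E3 → E3)
    (hmh : ∀ n, IsSchemeOutput Ω (K n) Cexch α θ (T / N n) (N n) (pih n) (fh n) (mh n) (vh n))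
    (hmh0 : Tendsto (fun n => toL2 Ω (mh n 0)) atTop (𝓝 m₀))
    (hGh0 : ∀ j, Tendsto (fun n => discreteGrad Ω (mh n 0) j) atTop (𝓝 (G₀ j)))
    (m : ℝ → L2 Ω) (hm : MemLp m 2 (volume.restrict (Ioo 0 T)))
    (hae : ∀ᵐ t ∂(volume.restrict (Ioo 0 T)), Tendsto
      (fun n => pwConst (T / N n) (fun i => toL2 Ω (mh n i)) t) atTop (𝓝 (m t)))
    (hpilim : Tendsto (fun n => eLpNorm
      (fun t => pwConst (T / N n) (fun i => pih n (toL2 Ω (mh n i))) t - pi (m t))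
      2 (volume.restrict (Ioo 0 T))) atTop (𝓝 0)) :
    ∃ (v : ℝ → L2 Ω) (B : ℝ), MemLp v 2 (volume.restrict (Ioo 0 T)) ∧
      (∀ᵐ t ∂(volume.restrict (Ioo 0 T)), m t = m₀ + ∫ s in (0)..t, v s) ∧
      ∀ᵐ t ∂(volume.restrict (Ioo 0 T)), ∃ G : Fin 3 → L2 Ω,
        HasWeakGradient Ω (m t) G ∧ (∀ i, ‖G i‖ ≤ B) ∧
        Cexch / 2 * gradInner G G + α * ∫ s in Ioo 0 t, ‖v s‖ ^ 2
          ≤ Cexch / 2 * gradInner G₀ G₀ + ∫ s in Ioo 0 t, inner ℝ (f - pi (m s)) (v s) := by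
  have hfin : volume Ω ≠ ⊤ :=
    ((measure_mono (subset_space (hK 0))).trans_lt (isCompact_space (hK 0)).measure_lt_top).ne
  have hTfin : IsFiniteMeasure (volume.restrict (Ioo 0 T)) := ⟨by simp⟩
  obtain ⟨B, hB0, hB⟩ := exists_uniform_bound hΩ hT hC hα hθ hN hK hKa hpih hfh hmh hGh0
  obtain ⟨k, hk_def⟩ : ∃ k : ℕ → ℝ, ∀ n, k n = T / N n := ⟨_, fun _ => rfl⟩
  simp only [← hk_def] at hmh hae hpilim hB
  have hk : ∀ n, 0 < k n := fun n => by
    rw [hk_def]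
    exact div_pos hT (by exact_mod_cast hN n)
  have hkT : ∀ n, N n * k n = T := fun n => by
    have : (N n : ℝ) ≠ 0 := by exact_mod_cast (hN n).ne'
    rw [hk_def]
    field_simp
  have hk0 : Tendsto k atTop (𝓝 0) :=
    (tendsto_const_nhds.div_atTop (tendsto_natCast_atTop_atTop.comp hN0)).congr
      fun n => (hk_def n).symm
  -- weak limits of the velocities
  obtain ⟨V, hV_def⟩ : ∃ V : ℕ → ℝ → L2 Ω,
      ∀ n, V n = pwConst (k n) (fun i => toL2 Ω (vh n i)) := ⟨_, fun _ => rfl⟩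
  have hV : ∀ n, MemLp (V n) 2 (volume.restrict (Ioo 0 T)) := fun n => by
    rw [hV_def]
    exact memLp_pwConst (hk n) (hkT n) _ 2
  have hVB : ∀ n, ‖(hV n).toLp (V n)‖ ≤ √B := fun n => by
    refine Real.le_sqrt_of_sq_le ?_
    rw [norm_toLp_sq]
    have h1 : ∫ s in Ioo 0 (N n * k n), ‖V n s‖ ^ 2
        = ∑ i ∈ Finset.range (N n), k n * ‖toL2 Ω (vh n i)‖ ^ 2 := by
      rw [hV_def]
      exact integral_pwConst (hk n) (fun i => ‖toL2 Ω (vh n i)‖ ^ 2) (N n)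
    rw [hkT] at h1
    rw [h1]
    exact (hB n).2
  obtain ⟨U, hU⟩ : ∃ U : Ultrafilter ℕ, (U : Filter ℕ) ≤ atTop := ⟨_, Nat.hyperfilter_le_atTop⟩
  obtain ⟨v, -, hv⟩ := exists_weak_limit U hVB
  have hvm : MemLp v 2 (volume.restrict (Ioo 0 T)) := Lp.memLp v
  have hvi : IntervalIntegrable v volume 0 T := by
    rw [intervalIntegrable_iff_integrableOn_Ioo_of_le hT.le]
    exact hvm.integrable (by norm_num)
  have hvit : ∀ t ∈ Ioo 0 T, IntervalIntegrable v volume 0 t := fun t ht =>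
    hvi.mono_set (uIcc_subset_uIcc_left (by rw [uIcc_of_le hT.le]; exact Ioo_subset_Icc_self ht))
  -- the discrete times
  obtain ⟨j, hj⟩ : ∃ j : ℝ → ℕ → ℕ, ∀ t n, j t n = ⌊t / k n⌋₊ := ⟨_, fun _ _ => rfl⟩
  have hjN : ∀ t ∈ Ioo 0 T, ∀ n, j t n ≤ N n := fun t ht n => by
    rw [hj]
    have h1 : t < N n * k n := by rw [hkT]; exact ht.2
    exact (floor_div_lt (hk n) ht.1.le h1).le
  have hjt : ∀ t ∈ Ioo 0 T, ∀ n, j t n * k n ≤ t := fun t ht n => by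
    have := Nat.floor_le (div_nonneg ht.1.le (hk n).le)
    rw [hj]
    rwa [le_div_iff₀ (hk n)] at this
  have hae : ∀ᵐ t ∂(volume.restrict (Ioo 0 T)),
      Tendsto (fun n => toL2 Ω (mh n (j t n))) atTop (𝓝 (m t)) :=
    hae.mono fun t ht => ht.congr fun n => by rw [hj, pwConst]
  have hjlim : ∀ t ∈ Ioo 0 T, Tendsto (fun n => j t n * k n) U (𝓝 t) := fun t ht =>
    ((tendsto_floor_mul hk hk0 ht.1.le).mono_left hU).congr fun n => by rw [hj]
  -- the limit is a primitive of `v`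
  have hmM : ∀ᵐ t ∂(volume.restrict (Ioo 0 T)), m t = m₀ + ∫ s in (0)..t, v s := by
    filter_upwards [hae, ae_restrict_mem measurableSet_Ioo] with t hmt ht
    refine L2_ext_of_inner_indicator hfin fun A hA hA' e => ?_
    obtain ⟨z, hz⟩ : ∃ z : L2 Ω, z = indicatorConstLp 2 hA hA' e := ⟨_, rfl⟩
    rw [← hz]
    have h1 : Tendsto (fun n => inner ℝ z (toL2 Ω (mh n (j t n)))) U (𝓝 (inner ℝ z (m t))) :=
      tendsto_const_nhds.inner (hmt.mono_left hU)
    have h2 : Tendsto (fun n => ∫ s in Ioo 0 (j t n * k n), inner ℝ z (V n s)) U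
        (𝓝 (∫ s in Ioo 0 t, inner ℝ z (v s))) :=
      tendsto_setIntegral_inner (g := fun _ => z) (gn := fun _ _ => z) (memLp_const z)
        (fun _ => memLp_const z) (by simp) hV hVB hv (hjt t ht) ht.2.le (hjlim t ht)
    have h3 : Tendsto (fun n => inner ℝ z (toL2 Ω (mh n 0))) U (𝓝 (inner ℝ z m₀)) :=
      tendsto_const_nhds.inner (hmh0.mono_left hU)
    have h4 := h1.sub (h3.add h2)
    have h5 : Tendsto (fun n => 33 * ‖e‖ * B * k n) U (𝓝 0) := by
      simpa using (hk0.mono_left hU).const_mul (33 * ‖e‖ * B)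
    have h6 := tendsto_nhds_unique h4 (squeeze_zero_norm (fun n => by
      have h := (hmh n).abs_inner_sub_le (hK n) hΩ (hk n) (hB n).2 hA hA' hfin e (hjN t ht n)
      rw [← hz, ← hV_def] at h
      exact h) h5)
    have h7 : ∫ s in Ioo 0 t, inner ℝ z (v s) = inner ℝ z (∫ s in (0)..t, v s) := by
      rw [← setIntegral_Ioo_eq v ht.1.le]
      exact integral_inner ((intervalIntegrable_iff_integrableOn_Ioo_of_le ht.1.le).1 (hvit t ht)) z
    rw [h7, ← inner_add_right] at h6
    exact sub_eq_zero.1 h6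
  -- the strong limit of the lower order terms
  obtain ⟨g, hg_def⟩ : ∃ g : ℝ → L2 Ω, ∀ s, g s = f - pi (m s) := ⟨_, fun _ => rfl⟩
  obtain ⟨gn, hgn_def⟩ : ∃ gn : ℕ → ℝ → L2 Ω,
      ∀ n, gn n = pwConst (k n) (fun i => fh n - pih n (toL2 Ω (mh n i))) := ⟨_, fun _ => rfl⟩
  have hpim : MemLp (fun s => pi (m s)) 2 (volume.restrict (Ioo 0 T)) := pi.comp_memLp' hm
  have hg : MemLp g 2 (volume.restrict (Ioo 0 T)) := by
    rw [show g = (fun _ => f) - fun s => pi (m s) from funext hg_def]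
    exact (memLp_const f).sub hpim
  have hgn : ∀ n, MemLp (gn n) 2 (volume.restrict (Ioo 0 T)) := fun n => by
    rw [hgn_def]
    exact memLp_pwConst (hk n) (hkT n) _ 2
  have hglim : Tendsto (fun n => eLpNorm (fun s => gn n s - g s) 2 (volume.restrict (Ioo 0 T)))
      atTop (𝓝 0) := by
    simp only [hgn_def, hg_def]
    exact tendsto_eLpNorm_const_sub hfh
      (fun n => (stronglyMeasurable_pwConst (k n)
        fun i => pih n (toL2 Ω (mh n i))).aestronglyMeasurable) hpim.aestronglyMeasurable hpilim
  -- the energy inequality in integrated form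
  have hA0 : Tendsto (fun n => gradInner (discreteGrad Ω (mh n 0)) (discreteGrad Ω (mh n 0))) U
      (𝓝 (gradInner G₀ G₀)) :=
    (tendsto_finsetSum _ fun i _ => (hGh0 i).inner (hGh0 i)).mono_left hU
  refine ⟨v, √B, hvm, hmM, ?_⟩
  filter_upwards [hae, ae_restrict_mem measurableSet_Ioo] with t hmt ht
  have hGB : ∀ i n, ‖discreteGrad Ω (mh n (j t n)) i‖ ≤ √B := fun i n => by
    refine Real.le_sqrt_of_sq_le (le_trans ?_ ((hB n).1 (j t n) (hjN t ht n)))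
    rw [gradInner_self]
    exact Finset.single_le_sum (f := fun i => ‖discreteGrad Ω (mh n (j t n)) i‖ ^ 2)
      (fun i _ => sq_nonneg _) (Finset.mem_univ i)
  choose G hGB' hG using fun i => exists_weak_limit U (hGB i)
  refine ⟨G, ?_, hGB', ?_⟩
  · exact hasWeakGradient_of_tendsto
      (fun n => hasWeakGradient_P1 (hK n) hΩ ((hmh n).mem_discreteMag (hjN t ht n)).1)
      (fun z => (hmt.mono_left hU).inner tendsto_const_nhds) hG
  · have h1 : Tendsto (fun n => gradInner (discreteGrad Ω (mh n (j t n))) G) U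
        (𝓝 (gradInner G G)) := tendsto_finsetSum _ fun i _ => hG i (G i)
    have h2 := tendsto_setIntegral_inner (l := U) (gn := fun _ => v) hvm (fun _ => hvm)
      (by simp) hV hVB hv (hjt t ht) ht.2.le (hjlim t ht)
    have h3 := tendsto_setIntegral_inner hg hgn (hglim.mono_left hU) hV hVB hv (hjt t ht) ht.2.le
      (hjlim t ht)
    have h4 := (((h1.const_mul 2).sub_const (gradInner G G)).const_mul (Cexch / 2)).add
      (((h2.const_mul 2).sub_const (∫ s in Ioo 0 t, ‖v s‖ ^ 2)).const_mul α)
    have h5 := (hA0.const_mul (Cexch / 2)).add h3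
    have h6 := le_of_tendsto_of_tendsto' h4 h5 fun n => by
      have h := (hmh n).energy_integral (hK n) hΩ (hKa n) hC hα hθ (hk n) (hjN t ht n)
        (hjt t ht n) ht.2.le G hvm
      rw [← hV_def, ← hgn_def] at h
      exact h
    simp only [real_inner_self_eq_norm_sq, hg_def] at h6
    linarith

/-- The limit of an almost everywhere in time convergent sequence of discrete solutions satisfies
the energy inequality. -/
theorem energy_inequality_of_ae_tendsto
    {Ω : Set E3} (hΩ : IsOpen Ω) {T Cexch α θ : ℝ} (hT : 0 < T) (hC : 0 < Cexch) (hα : 0 < α)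
    (hθ : 1 / 2 < θ) (pi : L2 Ω →L[ℝ] L2 Ω) (hpi : IsSelfAdjoint pi)
    (f m₀ : L2 Ω) (G₀ : Fin 3 → L2 Ω)
    (N : ℕ → ℕ) (hN : ∀ n, 0 < N n) (hN0 : Tendsto N atTop atTop)
    (K : ℕ → Geometry.SimplicialComplex ℝ E3) (hK : ∀ n, IsTriangulation (K n) Ω)
    (hKa : ∀ n, AngleCondition Ω (K n)) (pih : ℕ → L2 Ω → L2 Ω)
    (hpih : ∃ C : ℝ, ∀ n, ∀ (w : L2 Ω) (G : Fin 3 → L2 Ω), HasWeakGradient Ω w G →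
      (∀ᵐ x ∂(volume.restrict Ω), ‖w x‖ ≤ 1) → ‖pih n w‖ ≤ C * (1 + gradNorm G))
    (fh : ℕ → L2 Ω) (hfh : Tendsto fh atTop (𝓝 f)) (mh vh : ℕ → ℕ → E3 → E3)
    (hmh : ∀ n, IsSchemeOutput Ω (K n) Cexch α θ (T / N n) (N n) (pih n) (fh n) (mh n) (vh n))
    (hmh0 : Tendsto (fun n => toL2 Ω (mh n 0)) atTop (𝓝 m₀))
    (hGh0 : ∀ j, Tendsto (fun n => discreteGrad Ω (mh n 0) j) atTop (𝓝 (G₀ j)))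
    (m : ℝ → L2 Ω) (hm : MemLp m 2 (volume.restrict (Ioo 0 T)))
    (hae : ∀ᵐ t ∂(volume.restrict (Ioo 0 T)), Tendsto
      (fun n => pwConst (T / N n) (fun i => toL2 Ω (mh n i)) t) atTop (𝓝 (m t)))
    (hpilim : Tendsto (fun n => eLpNorm
      (fun t => pwConst (T / N n) (fun i => pih n (toL2 Ω (mh n i))) t - pi (m t))
      2 (volume.restrict (Ioo 0 T))) atTop (𝓝 0)) :
    ∃ (G : ℝ → Fin 3 → L2 Ω) (v : ℝ → L2 Ω), IsH1Cylinder Ω T m G v ∧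
      ∀ᵐ t ∂(volume.restrict (Ioo 0 T)),
        energy Cexch pi f (m t) (G t) + α * ∫ s in Ioo 0 t, ‖v s‖ ^ 2
          ≤ energy Cexch pi f m₀ G₀ := by
  have hTfin : IsFiniteMeasure (volume.restrict (Ioo 0 T)) := ⟨by simp⟩
  obtain ⟨v, B, hvm, hmM, hlimit⟩ := exists_velocity_and_gradient hΩ hT hC hα hθ pi f m₀ G₀ N hN hN0
    K hK hKa pih hpih fh hfh mh vh hmh hmh0 hGh0 m hm hae hpilim
  have hvi : IntervalIntegrable v volume 0 T := by
    rw [intervalIntegrable_iff_integrableOn_Ioo_of_le hT.le]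
    exact hvm.integrable (by norm_num)
  obtain ⟨G, hGm, hGw⟩ := exists_measurable_weakGradient hΩ hm.aestronglyMeasurable
    (hlimit.mono fun t ⟨G, hG, _⟩ => ⟨G, hG⟩)
  have hG : ∀ᵐ t ∂(volume.restrict (Ioo 0 T)), (∀ i, ‖G t i‖ ≤ B) ∧
      Cexch / 2 * gradInner (G t) (G t) + α * ∫ s in Ioo 0 t, ‖v s‖ ^ 2
        ≤ Cexch / 2 * gradInner G₀ G₀ + ∫ s in Ioo 0 t, inner ℝ (f - pi (m s)) (v s) := by
    filter_upwards [hlimit, hGw] with t ⟨G', h1, h2, h3⟩ h4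
    rw [hasWeakGradient_unique hΩ h4 h1]
    exact ⟨h2, h3⟩
  refine ⟨G, v, ⟨hm, fun i => MemLp.of_bound (hGm i) B (hG.mono fun t ht => ht.1 i), hvm, hGw,
    ?_⟩, ?_⟩
  · intro φ hφ _ hφT
    have hφ0 : ∀ t, t ∉ Ioo 0 T → φ t = 0 := fun t ht =>
      image_eq_zero_of_notMem_tsupport fun h => ht (hφT h)
    have h1 : ∫ t in Ioo 0 T, deriv φ t • m t = ∫ t in Ioo 0 T, deriv φ t • (m₀ + ∫ s in (0)..t, v s) :=
      integral_congr_ae (by filter_upwards [hmM] with t ht; rw [ht])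
    rw [h1, setIntegral_Ioo_eq _ hT.le, setIntegral_Ioo_eq _ hT.le]
    exact integral_deriv_smul_primitive hvi m₀ (hφ.of_le (by simp)) (hφ0 0 (by simp))
      (hφ0 T (by simp))
  · filter_upwards [hG, hmM, ae_restrict_mem measurableSet_Ioo] with t ⟨_, h1⟩ hmt ht
    have h2 := setIntegral_inner_affine pi hpi f m₀ hm hvm hmM ht hmt
    rw [h2] at h1
    rw [energy, energy, gradNorm_sq, gradNorm_sq]
    linarith

end LLG

theorem propositionA1
    -- the domain, the final time and the parameters
    (Ω : Set LLG.E3) (hΩ : IsOpen Ω) (hΩb : Bornology.IsBounded Ω)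
    (T Cexch α θ : ℝ) (hT : 0 < T) (hC : 0 < Cexch) (hα : 0 < α)
    (hθ : 1 / 2 < θ) (hθ1 : θ ≤ 1)
    -- the operator `π`: linear, bounded and self-adjoint on `L²`, bounded on `L⁴`
    (pi : LLG.L2 Ω →L[ℝ] LLG.L2 Ω) (hpi : IsSelfAdjoint pi)
    (hpi4 : ∃ C : ℝ≥0, ∀ w : LLG.L2 Ω, MemLp w 4 (volume.restrict Ω) →
      eLpNorm (pi w) 4 (volume.restrict Ω) ≤ C * eLpNorm w 4 (volume.restrict Ω))
    -- the applied field and the initial datum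
    (f : LLG.L2 Ω) (hf : MemLp f 4 (volume.restrict Ω))
    (m₀ : LLG.L2 Ω) (G₀ : Fin 3 → LLG.L2 Ω) (hG₀ : LLG.HasWeakGradient Ω m₀ G₀)
    (hm₀ : ∀ᵐ x ∂(volume.restrict Ω), ‖m₀ x‖ = 1)
    -- mesh-sizes and numbers of time steps
    (h : ℕ → ℝ) (hh : ∀ n, 0 < h n) (hh0 : Tendsto h atTop (𝓝 0))
    (N : ℕ → ℕ) (hN : ∀ n, 0 < N n) (hN0 : Tendsto N atTop atTop)
    -- the triangulations
    (K : ℕ → Geometry.SimplicialComplex ℝ LLG.E3) (hK : ∀ n, LLG.IsTriangulation (K n) Ω)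
    (hKq : ∃ κ : ℝ, ∀ n, LLG.IsQuasiUniform (K n) κ (h n))
    (hKa : ∀ n, LLG.AngleCondition Ω (K n))
    -- the discrete operators and the discrete applied fields
    (pih : ℕ → LLG.L2 Ω → LLG.L2 Ω)
    (hpih : ∃ C : ℝ, ∀ n, ∀ (w : LLG.L2 Ω) (G : Fin 3 → LLG.L2 Ω), LLG.HasWeakGradient Ω w G →
      (∀ᵐ x ∂(volume.restrict Ω), ‖w x‖ ≤ 1) → ‖pih n w‖ ≤ C * (1 + LLG.gradNorm G))
    (fh : ℕ → LLG.L2 Ω) (hfh : Tendsto fh atTop (𝓝 f))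
    -- the outputs of the integrator, with strongly convergent initial data
    (mh vh : ℕ → ℕ → LLG.E3 → LLG.E3)
    (hmh : ∀ n, LLG.IsSchemeOutput Ω (K n) Cexch α θ (T / N n) (N n) (pih n) (fh n)
      (mh n) (vh n))
    (hmh0 : Tendsto (fun n => LLG.toL2 Ω (mh n 0)) atTop (𝓝 m₀))
    (hGh0 : ∀ j, Tendsto (fun n => LLG.discreteGrad Ω (mh n 0) j) atTop (𝓝 (G₀ j)))
    -- the limit `m` of a subsequence, along which also `π_h(m_hk⁻) → π(m)`
    (m : ℝ → LLG.L2 Ω) (hm : MemLp m 2 (volume.restrict (Ioo 0 T)))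
    (σ : ℕ → ℕ) (hσ : StrictMono σ)
    (hlim : Tendsto (fun n => eLpNorm
      (fun t => LLG.pwConst (T / N (σ n)) (fun i => LLG.toL2 Ω (mh (σ n) i)) t - m t)
      2 (volume.restrict (Ioo 0 T))) atTop (𝓝 0))
    (hpilim : Tendsto (fun n => eLpNorm
      (fun t => LLG.pwConst (T / N (σ n))
        (fun i => pih (σ n) (LLG.toL2 Ω (mh (σ n) i))) t - pi (m t))
      2 (volume.restrict (Ioo 0 T))) atTop (𝓝 0)) :
    ∃ (G : ℝ → Fin 3 → LLG.L2 Ω) (v : ℝ → LLG.L2 Ω), LLG.IsH1Cylinder Ω T m G v ∧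
      ∀ᵐ t ∂(volume.restrict (Ioo 0 T)),
        LLG.energy Cexch pi f (m t) (G t) + α * ∫ s in Ioo 0 t, ‖v s‖ ^ 2
          ≤ LLG.energy Cexch pi f m₀ G₀ := by
  have : IsFiniteMeasure (volume.restrict (Ioo 0 T)) := ⟨by simp⟩
  have hk : ∀ n, 0 < T / N n := fun n => div_pos hT (by exact_mod_cast hN n)
  have hkT : ∀ n, N n * (T / N n) = T := fun n => by
    have : (N n : ℝ) ≠ 0 := by exact_mod_cast (hN n).ne'
    field_simp
  obtain ⟨τ, hτ, hae⟩ := (tendstoInMeasure_of_tendsto_eLpNorm (by norm_num)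
    (fun n => (LLG.memLp_pwConst (hk (σ n)) (hkT (σ n)) _ 2).aestronglyMeasurable)
    hm.aestronglyMeasurable hlim).exists_seq_tendsto_ae
  have hs : Tendsto (fun n => σ (τ n)) atTop atTop := hσ.tendsto_atTop.comp hτ.tendsto_atTop
  obtain ⟨C, hCpi⟩ := hpih
  exact LLG.energy_inequality_of_ae_tendsto hΩ hT hC hα hθ pi hpi f m₀ G₀ (fun n => N (σ (τ n)))
    (fun n => hN _) (hN0.comp hs) (fun n => K (σ (τ n))) (fun n => hK _) (fun n => hKa _)
    (fun n => pih (σ (τ n))) ⟨C, fun n => hCpi _⟩ (fun n => fh (σ (τ n))) (hfh.comp hs)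
    (fun n => mh (σ (τ n))) (fun n => vh (σ (τ n))) (fun n => hmh _) (hmh0.comp hs)
    (fun j => (hGh0 j).comp hs) m hm hae (hpilim.comp hτ.tendsto_atTop)
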